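/- **Theorem 2.1.** Let $\nu\ge 1$ and $N\ge 1$ be integers, let $U:\mathbb{R}^\nu\to\mathbb{R}$ be measurable and let $V\in L^\infty(\mathbb{R}^\nu)$ be real valued, with $\|V\|=\|V\|_{L^\infty}$. For $M\ge 1$ let $$H_M=\sum_{j=1}^M\bigl(-\Delta_{x_j}+U(x_j)\bigr)+\frac1M\sum_{1\le i<j\le M}V(x_i-x_j)$$ act on $L^2((\mathbb{R}^\nu)^M)$ with its maximal domain, i.e. the set of all $\psi\in L^2$ such that (potential)$\,\cdot\psi$ is locally integrable and $H_M\psi$, computed in the sense of distributions, lies in $L^2$. Assume that $U$ and $V$ are such that $H_1=-\Delta+U$ and $H_N$ are self-adjoint, and let $e^{-iH_Nt}$, $t\in\mathbb{R}$, be the strongly continuous unitary group generated by $H_N$. For a bounded operator $A$ on $L^2((\mathbb{R}^\nu)^m)$ and integers $1\le i_1<\dots<i_m\le N$ let $A^{[i_1,\dots,i_m]}$ be the bounded operator on $L^2((\mathbb{R}^\nu)^N)$ that acts as $A$ on the particles $i_1,\dots,i_m$ and as the identity on all other particles. Then for all integers $m,n\ge 1$, all bounded operators $A$ on $L^2((\mathbb{R}^\nu)^m)$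 and $B$ on $L^2((\mathbb{R}^\nu)^n)$, all integers $1\le i_1<\dots<i_m\le N$ and $1\le j_1<\dots<j_n\le N$ with $\{i_1,\dots,i_m\}\cap\{j_1,\dots,j_n\}=\emptyset$, and all $t\in\mathbb{R}$, $$\Bigl\|\bigl[A^{[i_1,\dots,i_m]},\,e^{iH_Nt}B^{[j_1,\dots,j_n]}e^{-iH_Nt}\bigr]\Bigr\|\le\frac{mn\,\|A\|\,\|B\|}{N}\bigl(e^{4\|V\||t|}-1\bigr).$$ All norms of operators are operator norms on the respective $L^2$ spaces. -/

import Mathlib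

open MeasureTheory
open scoped ContDiff TensorProduct Laplacian

noncomputable section

namespace MeanField

/-- One-particle configuration space `ℝ^ν`. -/
abbrev Space (ν : ℕ) := EuclideanSpace ℝ (Fin ν)

/-- The Hilbert space `L²((ℝ^ν)^ι)` of complex wave functions of particles labelled by `ι`. -/
abbrev L2 (ν : ℕ) (ι : Type) [Fintype ι] := Lp ℂ 2 (volume : Measure (ι → Space ν))

section Tensor

variable {X Y : Type*} [MeasurableSpace X] [MeasurableSpace Y] (μ : Measure X) (ρ : Measure Y)

theorem memLp_tensor (f : Lp ℂ 2 μ) (g : Lp ℂ 2 ρ) :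
    MemLp (fun z : X × Y => f z.1 * g z.2) 2 (μ.prod ρ) := by
  have hf := (Lp.memLp f)
  have hg := (Lp.memLp g)
  have hm : AEStronglyMeasurable (fun z : X × Y => f z.1 * g z.2) (μ.prod ρ) :=
    hf.1.comp_fst.mul hg.1.comp_snd
  rw [memLp_two_iff_integrable_sq_norm hm]
  have h := ((memLp_two_iff_integrable_sq_norm hf.1).1 hf).mul_prod
    ((memLp_two_iff_integrable_sq_norm hg.1).1 hg)
  simpa [mul_pow] using h

/-- The function `(x, y) ↦ f x * g y` in `L²(X × Y)`. -/
def tensorFun (f : Lp ℂ 2 μ) (g : Lp ℂ 2 ρ) : Lp ℂ 2 (μ.prod ρ) := (memLp_tensor μ ρ f g).toLp _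

theorem coeFn_tensorFun (f : Lp ℂ 2 μ) (g : Lp ℂ 2 ρ) :
    tensorFun μ ρ f g =ᵐ[μ.prod ρ] fun z => f z.1 * g z.2 := MemLp.coeFn_toLp _

variable [SigmaFinite μ] [SigmaFinite ρ]

theorem inner_tensorFun (f f' : Lp ℂ 2 μ) (g g' : Lp ℂ 2 ρ) :
    inner ℂ (tensorFun μ ρ f g) (tensorFun μ ρ f' g') = inner ℂ f f' * inner ℂ g g' := by
  rw [L2.inner_def, L2.inner_def, L2.inner_def, ← integral_prod_mul]
  refine integral_congr_ae ?_
  filter_upwards [coeFn_tensorFun μ ρ f g, coeFn_tensorFun μ ρ f' g'] with z h1 h2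
  simp only [h1, h2, RCLike.inner_apply, map_mul]
  ring

/-- `tensorFun` as a bilinear map. -/
def tensorBilin : Lp ℂ 2 μ →ₗ[ℂ] Lp ℂ 2 ρ →ₗ[ℂ] Lp ℂ 2 (μ.prod ρ) :=
  LinearMap.mk₂ ℂ (tensorFun μ ρ)
    (fun f f' g => by
      refine Lp.ext ?_
      filter_upwards [coeFn_tensorFun μ ρ (f + f') g, coeFn_tensorFun μ ρ f g,
        coeFn_tensorFun μ ρ f' g, Lp.coeFn_add (tensorFun μ ρ f g) (tensorFun μ ρ f' g),
        Measure.quasiMeasurePreserving_fst.ae (Lp.coeFn_add f f')] with z h1 h2 h3 h4 h5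
      rw [h4, Pi.add_apply, h1, h2, h3, h5, Pi.add_apply, add_mul])
    (fun c f g => by
      refine Lp.ext ?_
      filter_upwards [coeFn_tensorFun μ ρ (c • f) g, coeFn_tensorFun μ ρ f g,
        Lp.coeFn_smul c (tensorFun μ ρ f g),
        Measure.quasiMeasurePreserving_fst.ae (Lp.coeFn_smul c f)] with z h1 h2 h4 h5
      rw [h4, Pi.smul_apply, h1, h2, h5, Pi.smul_apply, smul_mul_assoc])
    (fun f g g' => by
      refine Lp.ext ?_
      filter_upwards [coeFn_tensorFun μ ρ f (g + g'), coeFn_tensorFun μ ρ f g,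
        coeFn_tensorFun μ ρ f g', Lp.coeFn_add (tensorFun μ ρ f g) (tensorFun μ ρ f g'),
        Measure.quasiMeasurePreserving_snd.ae (Lp.coeFn_add g g')] with z h1 h2 h3 h4 h5
      rw [h4, Pi.add_apply, h1, h2, h3, h5, Pi.add_apply, mul_add])
    (fun c f g => by
      refine Lp.ext ?_
      filter_upwards [coeFn_tensorFun μ ρ f (c • g), coeFn_tensorFun μ ρ f g,
        Lp.coeFn_smul c (tensorFun μ ρ f g),
        Measure.quasiMeasurePreserving_snd.ae (Lp.coeFn_smul c g)] with z h1 h2 h4 h5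
      rw [h4, Pi.smul_apply, h1, h2, h5, Pi.smul_apply, mul_smul_comm])

/-- The canonical isometry `L²(X) ⊗ L²(Y) → L²(X × Y)` from the algebraic tensor product. -/
def tensorIso : (Lp ℂ 2 μ ⊗[ℂ] Lp ℂ 2 ρ) →ₗᵢ[ℂ] Lp ℂ 2 (μ.prod ρ) :=
  (TensorProduct.lift (tensorBilin μ ρ)).isometryOfInner (by
    intro x y
    induction x with
    | zero => simp
    | add x x' hx hx' => simp only [map_add, inner_add_left, hx, hx']
    | tmul f g =>
      induction y with
      | zero => simp
      | add y y' hy hy' => simp only [map_add, inner_add_right, hy, hy']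
      | tmul f' g' =>
        simp only [TensorProduct.lift.tmul, TensorProduct.inner_tmul]
        exact inner_tensorFun μ ρ f f' g g')

theorem tensorIso_tmul (f : Lp ℂ 2 μ) (g : Lp ℂ 2 ρ) :
    tensorIso μ ρ (f ⊗ₜ g) = tensorFun μ ρ f g := rfl

theorem eq_zero_of_inner_tensorFun_eq_zero (h : Lp ℂ 2 (μ.prod ρ))
    (h0 : ∀ f g, inner ℂ (tensorFun μ ρ f g) h = 0) : h = 0 := by
  have hrect : ∀ s t, MeasurableSet s → MeasurableSet t → μ s ≠ ⊤ → ρ t ≠ ⊤ →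
      ∫ z in s ×ˢ t, h z ∂(μ.prod ρ) = 0 := by
    intro s t hs ht hμs hρt
    rw [← h0 (indicatorConstLp 2 hs hμs 1) (indicatorConstLp 2 ht hρt 1), L2.inner_def,
      ← integral_indicator (hs.prod ht)]
    refine integral_congr_ae ?_
    filter_upwards [coeFn_tensorFun μ ρ (indicatorConstLp 2 hs hμs 1) (indicatorConstLp 2 ht hρt 1),
      Measure.quasiMeasurePreserving_fst.ae (indicatorConstLp_coeFn (p := 2) (hs := hs)
        (hμs := hμs) (c := (1 : ℂ))),
      Measure.quasiMeasurePreserving_snd.ae (indicatorConstLp_coeFn (p := 2) (hs := ht)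
        (hμs := hρt) (c := (1 : ℂ)))] with z h1 h2 h3
    rw [h1, h2, h3]
    by_cases hz1 : z.1 ∈ s <;> by_cases hz2 : z.2 ∈ t <;>
      simp [Set.indicator, hz1, hz2, Set.mem_prod]
  have hbox : ∀ k : ℕ, ∀ᵐ z ∂(μ.prod ρ),
      z ∈ spanningSets μ k ×ˢ spanningSets ρ k → h z = 0 := by
    intro k
    have hP1 := measurableSet_spanningSets μ k
    have hP2 := measurableSet_spanningSets ρ k
    have hf1 := (measure_spanningSets_lt_top μ k)
    have hf2 := (measure_spanningSets_lt_top ρ k)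
    set P := spanningSets μ k ×ˢ spanningSets ρ k with hP
    have hPm : MeasurableSet P := hP1.prod hP2
    have hPfin : (μ.prod ρ) P ≠ ⊤ := by
      rw [hP, Measure.prod_prod]
      exact ENNReal.mul_ne_top hf1.ne hf2.ne
    have hint : IntegrableOn h P (μ.prod ρ) := by
      have : IsFiniteMeasure ((μ.prod ρ).restrict P) :=
        ⟨by rw [Measure.restrict_apply_univ]; exact hPfin.lt_top⟩
      exact ((Lp.memLp h).restrict P).integrable (by norm_num)
    rw [← ae_restrict_iff' hPm]
    refine Integrable.ae_eq_zero_of_forall_setIntegral_eq_zero hint ?_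
    intro S hS _
    rw [Measure.restrict_restrict hS]
    induction S, hS using MeasurableSpace.induction_on_inter
      generateFrom_prod.symm isPiSystem_prod with
    | empty => simp
    | basic S hS =>
      obtain ⟨s, hs, t, ht, rfl⟩ := hS
      rw [hP, Set.prod_inter_prod]
      exact hrect _ _ (MeasurableSet.inter hs hP1) (MeasurableSet.inter ht hP2)
        (measure_ne_top_of_subset Set.inter_subset_right hf1.ne)
        (measure_ne_top_of_subset Set.inter_subset_right hf2.ne)
    | compl S hS ih =>
      have ih := ih (by exact measure_lt_top_of_subset (Set.subset_univ _) (by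
        rw [Measure.restrict_apply_univ]; exact hPfin))
      have hA := integral_inter_add_sdiff (f := h) (s := P) hS hint
      rw [Set.inter_comm, ih, zero_add] at hA
      have hT : ∫ z in P, h z ∂(μ.prod ρ) = 0 := hrect _ _ hP1 hP2 hf1.ne hf2.ne
      rw [hT, Set.sdiff_eq, Set.inter_comm] at hA
      exact hA
    | iUnion f hd hf ih =>
      rw [Set.iUnion_inter, integral_iUnion (fun i => (hf i).inter hPm)
        (fun i j hij => (hd hij).mono Set.inter_subset_left Set.inter_subset_left)
        (hint.mono_set (Set.iUnion_subset fun i => Set.inter_subset_right))]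
      refine (tsum_congr fun i => ih i (by
        exact measure_lt_top_of_subset (Set.subset_univ _) (by
          rw [Measure.restrict_apply_univ]; exact hPfin))).trans tsum_zero
  rw [Lp.eq_zero_iff_ae_eq_zero]
  filter_upwards [ae_all_iff.2 hbox] with z hz
  obtain ⟨a, ha⟩ := Set.mem_iUnion.1 ((iUnion_spanningSets μ).symm ▸ Set.mem_univ z.1)
  obtain ⟨b, hb⟩ := Set.mem_iUnion.1 ((iUnion_spanningSets ρ).symm ▸ Set.mem_univ z.2)
  exact hz (max a b) ⟨monotone_spanningSets μ (le_max_left a b) ha,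
    monotone_spanningSets ρ (le_max_right a b) hb⟩

theorem denseRange_tensorIso : DenseRange (tensorIso μ ρ) := by
  have key : (LinearMap.range (tensorIso μ ρ).toLinearMap)ᗮ = ⊥ := by
    rw [Submodule.eq_bot_iff]
    intro h hh
    refine eq_zero_of_inner_tensorFun_eq_zero μ ρ h fun f g => ?_
    rw [← tensorIso_tmul]
    exact (Submodule.mem_orthogonal _ _).1 hh _ ⟨_, rfl⟩
  have h2 := Submodule.dense_iff_topologicalClosure_eq_top.2
    ((Submodule.topologicalClosure_eq_top_iff
      (K := LinearMap.range (tensorIso μ ρ).toLinearMap)).2 key)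
  exact h2

end Tensor

section Particles

variable {ν m N : ℕ}

/-- Restriction of a configuration of `N` particles to the particles `i 0 < i 1 < ⋯` and to the
remaining ones. -/
def splitAt (i : Fin m ↪o Fin N) (x : Fin N → Space ν) :
    (Fin m → Space ν) × ({k // k ∉ Set.range i} → Space ν) :=
  (fun a => x (i a), fun k => x k)

theorem exists_splitAt_equiv (i : Fin m ↪o Fin N) :
    ∃ e : (Fin N → Space ν) ≃ᵐ (Fin m → Space ν) × ({k // k ∉ Set.range i} → Space ν),
      ⇑e = splitAt i ∧ MeasurePreserving e volume (volume.prod volume) := by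
  let r : Fin m ≃ {k // k ∈ Set.range i} := Equiv.ofInjective i i.injective
  have h1 := volume_preserving_piEquivPiSubtypeProd (fun _ : Fin N => Space ν)
    (fun k => k ∈ Set.range i)
  have h2 := volume_measurePreserving_piCongrLeft (fun _ : {k // k ∈ Set.range i} => Space ν) r
  rw [Subsingleton.elim (Set.fintypeRange i) (Subtype.fintype fun k => k ∈ Set.range i)] at h2
  refine ⟨(MeasurableEquiv.piEquivPiSubtypeProd (fun _ : Fin N => Space ν)
    (fun k => k ∈ Set.range i)).trans (MeasurableEquiv.prodCongr
      (MeasurableEquiv.piCongrLeft (fun _ : {k // k ∈ Set.range i} => Space ν) r).symm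
      (MeasurableEquiv.refl _)), ?_, ?_⟩
  · funext x
    exact Prod.ext (funext fun a => rfl) rfl
  · have h3 := (h2.symm.prod (MeasurePreserving.id
      (volume : Measure ({k // k ∉ Set.range i} → Space ν))))
    rw [Measure.volume_eq_prod] at h1
    exact h3.comp h1

theorem measurePreserving_splitAt (i : Fin m ↪o Fin N) :
    MeasurePreserving (splitAt (ν := ν) i) volume (volume.prod volume) := by
  obtain ⟨e, he, h⟩ := exists_splitAt_equiv (ν := ν) i
  rwa [he] at h

/-- The canonical isometry
`L²((ℝ^ν)^m) ⊗ L²((ℝ^ν)^(N - m)) → L²((ℝ^ν)^N)` from the algebraic tensor product, which puts the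
first factor on the particles `i 0 < i 1 < ⋯` and the second one on the remaining particles. -/
def embedAt (i : Fin m ↪o Fin N) :
    (L2 ν (Fin m) ⊗[ℂ] L2 ν {k // k ∉ Set.range i}) →ₗᵢ[ℂ] L2 ν (Fin N) :=
  (Lp.compMeasurePreservingₗᵢ ℂ (splitAt i) (measurePreserving_splitAt i)).comp
    (tensorIso volume volume)

theorem coeFn_embedAt_tmul (i : Fin m ↪o Fin N) (f : L2 ν (Fin m))
    (g : L2 ν {k // k ∉ Set.range i}) :
    embedAt i (f ⊗ₜ g) =ᵐ[volume] fun x => f (fun a => x (i a)) * g (fun k => x k) :=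
  (Lp.coeFn_compMeasurePreserving (tensorFun volume volume f g)
    (measurePreserving_splitAt i)).trans
    ((measurePreserving_splitAt i).quasiMeasurePreserving.ae (coeFn_tensorFun volume volume f g))

theorem denseRange_embedAt (i : Fin m ↪o Fin N) : DenseRange (embedAt (ν := ν) i) := by
  suffices hs : Function.Surjective (Lp.compMeasurePreservingₗᵢ (E := ℂ) (p := 2) ℂ
      (splitAt (ν := ν) i) (measurePreserving_splitAt i)) from
    hs.denseRange.comp (denseRange_tensorIso volume volume) (LinearIsometry.continuous _)
  intro h
  obtain ⟨e, he, hm⟩ := exists_splitAt_equiv (ν := ν) i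
  refine ⟨Lp.compMeasurePreserving e.symm hm.symm h, Lp.ext ?_⟩
  refine (Lp.coeFn_compMeasurePreserving _ (measurePreserving_splitAt i)).trans ?_
  have h1 := (measurePreserving_splitAt i).quasiMeasurePreserving.ae
    (Lp.coeFn_compMeasurePreserving h hm.symm)
  filter_upwards [h1] with x hx
  rw [Function.comp_apply, hx, Function.comp_apply, ← he, e.symm_apply_apply]

/-- The operator `A^{[i₁, …, iₘ]}` acting as `A` on the particles `i 0 < i 1 < ⋯` and as the
identity on all other particles: the bounded extension of `A ⊗ 1`. -/
def onParticles (i : Fin m ↪o Fin N) (A : L2 ν (Fin m) →L[ℂ] L2 ν (Fin m)) :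
    L2 ν (Fin N) →L[ℂ] L2 ν (Fin N) :=
  ((embedAt i).toContinuousLinearMap ∘L A.rTensor (L2 ν {k // k ∉ Set.range i})).extend
    (embedAt i).toContinuousLinearMap

theorem onParticles_embedAt_tmul (i : Fin m ↪o Fin N) (A : L2 ν (Fin m) →L[ℂ] L2 ν (Fin m))
    (f : L2 ν (Fin m)) (g : L2 ν {k // k ∉ Set.range i}) :
    onParticles i A (embedAt i (f ⊗ₜ g)) = embedAt i (A f ⊗ₜ g) := by
  have h := ContinuousLinearMap.extend_eq
    ((embedAt i).toContinuousLinearMap ∘L A.rTensor (L2 ν {k // k ∉ Set.range i}))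
    (e := (embedAt i).toContinuousLinearMap)
    (denseRange_embedAt i) (embedAt i).isometry.isUniformInducing (f ⊗ₜ g)
  exact h

end Particles

section Hamiltonian

variable {ν N : ℕ}

/-- The Laplacian `Δ_{x_j}` in the position of the `j`-th particle. -/
def particleLaplacian (j : Fin N) (f : (Fin N → Space ν) → ℂ) (x : Fin N → Space ν) : ℂ :=
  (Δ (fun y : Space ν => f (Function.update x j y))) (x j)

/-- The total potential `∑ⱼ U(x_j) + (1/N) ∑_{i<j} V(x_i - x_j)`. -/
def potential (U V : Space ν → ℝ) (x : Fin N → Space ν) : ℝ :=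
  (∑ j, U (x j)) + (1 / N : ℝ) * ∑ i, ∑ j with i < j, V (x i - x j)

/-- Test functions `C_c^∞((ℝ^ν)^N)`. -/
def IsTestFunction (f : (Fin N → Space ν) → ℂ) : Prop := ContDiff ℝ ∞ f ∧ HasCompactSupport f

theorem two_le_infty : (2 : WithTop ℕ∞) ≤ ∞ := by
  exact WithTop.coe_le_coe.2 le_top

theorem particleLaplacian_eq (j : Fin N) {f : (Fin N → Space ν) → ℂ} (hf : ContDiff ℝ ∞ f)
    (x : Fin N → Space ν) : particleLaplacian j f x = ∑ k : Fin ν, iteratedFDeriv ℝ 2 f x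
      (fun _ => Pi.single j (EuclideanSpace.single k 1)) := by
  let L : Space ν →L[ℝ] (Fin N → Space ν) := ContinuousLinearMap.single ℝ (fun _ => Space ν) j
  have h1 : (fun y : Space ν => f (Function.update x j y)) =
      (fun z => f (Function.update x j 0 + z)) ∘ L := by
    funext y
    simp only [Function.comp_apply]
    congr 1
    funext k
    by_cases hk : k = j
    · subst hk; simp [L]
    · simp [L, hk]
  have h2 : Function.update x j 0 + L (x j) = x := by
    funext k
    by_cases hk : k = j
    · subst hk; simp [L]
    · simp [L, hk]
  have h3 : ContDiff ℝ 2 fun z => f (Function.update x j 0 + z) :=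
    (hf.of_le two_le_infty).comp (contDiff_const.add contDiff_id)
  unfold particleLaplacian
  rw [InnerProductSpace.laplacian_eq_iteratedFDeriv_orthonormalBasis _
    (EuclideanSpace.basisFun (Fin ν) ℝ), h1]
  refine Finset.sum_congr rfl fun k _ => ?_
  rw [L.iteratedFDeriv_comp_right h3 _ le_rfl, iteratedFDeriv_comp_add_left, h2]
  simp only [ContinuousMultilinearMap.compContinuousLinearMap_apply]
  congr 1
  funext a
  fin_cases a <;> simp [L]

theorem IsTestFunction.continuous_particleLaplacian {f : (Fin N → Space ν) → ℂ}
    (hf : IsTestFunction f) (j : Fin N) : Continuous (particleLaplacian j f) := by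
  rw [funext (particleLaplacian_eq j hf.1)]
  refine continuous_finsetSum _ fun k _ => ?_
  exact (ContinuousMultilinearMap.apply ℝ (fun _ : Fin 2 => Fin N → Space ν) ℂ
    (fun _ => Pi.single j (EuclideanSpace.single k 1))).continuous.comp
    (hf.1.continuous_iteratedFDeriv (m := 2) two_le_infty)

theorem IsTestFunction.hasCompactSupport_particleLaplacian {f : (Fin N → Space ν) → ℂ}
    (hf : IsTestFunction f) (j : Fin N) : HasCompactSupport (particleLaplacian j f) := by
  refine (hf.2.iteratedFDeriv (𝕜 := ℝ) 2).mono fun x hx hx' => hx ?_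
  rw [particleLaplacian_eq j hf.1]
  refine Finset.sum_eq_zero fun k _ => ?_
  rw [hx']
  rfl

theorem integrable_mul_test {φ g : (Fin N → Space ν) → ℂ} (hφ : LocallyIntegrable φ)
    (hg : Continuous g) (hc : HasCompactSupport g) : Integrable (fun x => φ x * g x) := by
  simpa [mul_comm] using hφ.integrable_smul_left_of_hasCompactSupport hg hc

theorem locallyIntegrable_L2 (ψ : L2 ν (Fin N)) : LocallyIntegrable (fun x => ψ x) :=
  (Lp.memLp ψ).locallyIntegrable (by norm_num)

theorem IsTestFunction.integrable_kinetic {f : (Fin N → Space ν) → ℂ}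
    (hf : IsTestFunction f) (ψ : L2 ν (Fin N)) :
    Integrable fun x => ψ x * (-∑ j, particleLaplacian j f x) := by
  have h : Integrable fun x => -∑ j, ψ x * particleLaplacian j f x :=
    (integrable_finsetSum _ fun j _ => integrable_mul_test (locallyIntegrable_L2 ψ)
      (hf.continuous_particleLaplacian j) (hf.hasCompactSupport_particleLaplacian j)).neg
  simpa [Finset.mul_sum] using h

/-- `χ = (∑ⱼ (-Δ_{x_j} + U(x_j)) + (1/N) ∑_{i<j} V(x_i - x_j)) ψ` in the sense of distributions. -/
def WeakHamiltonian (U V : Space ν → ℝ) (ψ χ : L2 ν (Fin N)) : Prop :=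
  LocallyIntegrable (fun x => (potential U V x : ℂ) * ψ x) ∧
  ∀ f : (Fin N → Space ν) → ℂ, IsTestFunction f →
    ∫ x, χ x * f x =
      (∫ x, ψ x * (-∑ j, particleLaplacian j f x)) + ∫ x, (potential U V x : ℂ) * ψ x * f x

/-- The graph of the Hamiltonian on its maximal domain, as a linear subspace. -/
def hamiltonianGraph (U V : Space ν → ℝ) (N : ℕ) :
    Submodule ℂ (L2 ν (Fin N) × L2 ν (Fin N)) where
  carrier := {p | WeakHamiltonian U V p.1 p.2}
  zero_mem' := by
    have h0 : ∀ᵐ x, (0 : L2 ν (Fin N)) x = 0 := Lp.coeFn_zero _ _ _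
    refine ⟨(locallyIntegrable_zero (μ := volume)).congr ?_, fun f hf => ?_⟩
    · filter_upwards [h0] with x hx
      simp
    · have h1 : ∀ g : (Fin N → Space ν) → ℂ, ∫ x, (0 : L2 ν (Fin N)) x * g x = 0 := fun g => by
        refine integral_eq_zero_of_ae ?_
        filter_upwards [h0] with x hx
        simp
      have h2 : ∫ x, (potential U V x : ℂ) * (0 : L2 ν (Fin N)) x * f x = 0 := by
        refine integral_eq_zero_of_ae ?_
        filter_upwards [h0] with x hx
        simp
      simp only [Prod.fst_zero, Prod.snd_zero]
      rw [h1, h1, h2, add_zero]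
  add_mem' := by
    rintro ⟨ψ, χ⟩ ⟨ψ', χ'⟩ ⟨h1, h2⟩ ⟨h1', h2'⟩
    have hψ := Lp.coeFn_add ψ ψ'
    have hχ := Lp.coeFn_add χ χ'
    refine ⟨(h1.add h1').congr ?_, fun f hf => ?_⟩
    · filter_upwards [hψ] with x hx
      simp only [Prod.fst_add, Pi.add_apply, hx, mul_add]
    · have e1 : ∫ x, (χ + χ') x * f x = ∫ x, χ x * f x + χ' x * f x := by
        refine integral_congr_ae ?_
        filter_upwards [hχ] with x hx
        rw [hx, Pi.add_apply, add_mul]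
      have e2 : ∫ x, (ψ + ψ') x * (-∑ j, particleLaplacian j f x) =
          ∫ x, ψ x * (-∑ j, particleLaplacian j f x)
            + ψ' x * (-∑ j, particleLaplacian j f x) := by
        refine integral_congr_ae ?_
        filter_upwards [hψ] with x hx
        rw [hx, Pi.add_apply, add_mul]
      have e3 : ∫ x, (potential U V x : ℂ) * (ψ + ψ') x * f x =
          ∫ x, (potential U V x : ℂ) * ψ x * f x + (potential U V x : ℂ) * ψ' x * f x := by
        refine integral_congr_ae ?_
        filter_upwards [hψ] with x hx
        rw [hx, Pi.add_apply, mul_add, add_mul]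
      have hc := hf.1.continuous
      simp only [Prod.fst_add, Prod.snd_add]
      rw [e1, e2, e3, integral_add (integrable_mul_test (locallyIntegrable_L2 χ) hc hf.2)
          (integrable_mul_test (locallyIntegrable_L2 χ') hc hf.2),
        integral_add (hf.integrable_kinetic ψ) (hf.integrable_kinetic ψ'),
        integral_add (integrable_mul_test h1 hc hf.2) (integrable_mul_test h1' hc hf.2),
        h2 f hf, h2' f hf]
      ring
  smul_mem' := by
    rintro c ⟨ψ, χ⟩ ⟨h1, h2⟩
    have hψ := Lp.coeFn_smul c ψ
    have hχ := Lp.coeFn_smul c χ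
    refine ⟨(h1.smul c).congr ?_, fun f hf => ?_⟩
    · filter_upwards [hψ] with x hx
      simp only [Prod.smul_fst, hx, Pi.smul_apply, smul_eq_mul]
      ring
    · have e1 : ∫ x, (c • χ) x * f x = ∫ x, c * (χ x * f x) := by
        refine integral_congr_ae ?_
        filter_upwards [hχ] with x hx
        simp [hx, mul_assoc]
      have e2 : ∫ x, (c • ψ) x * (-∑ j, particleLaplacian j f x) =
          ∫ x, c * (ψ x * (-∑ j, particleLaplacian j f x)) := by
        refine integral_congr_ae ?_
        filter_upwards [hψ] with x hx
        rw [hx, Pi.smul_apply, smul_eq_mul, mul_assoc]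
      have e3 : ∫ x, (potential U V x : ℂ) * (c • ψ) x * f x =
          ∫ x, c * ((potential U V x : ℂ) * ψ x * f x) := by
        refine integral_congr_ae ?_
        filter_upwards [hψ] with x hx
        rw [hx, Pi.smul_apply, smul_eq_mul]
        ring
      simp only [Prod.smul_fst, Prod.smul_snd]
      rw [e1, e2, e3, integral_const_mul, integral_const_mul, integral_const_mul, h2 f hf]
      ring

/-- The Hamiltonian `H_N = ∑ⱼ (-Δ_{x_j} + U(x_j)) + (1/N) ∑_{i<j} V(x_i - x_j)` as an unbounded
operator on `L²((ℝ^ν)^N)` with its maximal domain: all `ψ` for which the potential energy term is a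
locally integrable function and `H_N ψ`, computed in the sense of distributions, is in `L²`. -/
def hamiltonian (U V : Space ν → ℝ) (N : ℕ) : L2 ν (Fin N) →ₗ.[ℂ] L2 ν (Fin N) :=
  (hamiltonianGraph U V N).toLinearPMap

theorem mem_graph_hamiltonian (U V : Space ν → ℝ) (ψ χ : L2 ν (Fin N)) :
    (ψ, χ) ∈ (hamiltonian U V N).graph ↔ WeakHamiltonian U V ψ χ := by
  have h : (hamiltonian U V N).graph = hamiltonianGraph U V N := by
    refine Submodule.toLinearPMap_graph_eq _ ?_
    rintro ⟨ψ, χ⟩ ⟨-, h⟩ h0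
    have h0 : ψ = 0 := h0
    subst h0
    have hz : ∀ᵐ x, (0 : L2 ν (Fin N)) x = 0 := Lp.coeFn_zero _ _ _
    rw [Lp.eq_zero_iff_ae_eq_zero]
    refine ae_eq_zero_of_integral_contDiff_smul_eq_zero (locallyIntegrable_L2 χ) fun g hg hgc => ?_
    have hf : IsTestFunction (fun x => (g x : ℂ) : (Fin N → Space ν) → ℂ) :=
      ⟨Complex.ofRealCLM.contDiff.comp hg, hgc.comp_left Complex.ofReal_zero⟩
    have h1 := h _ hf
    have e2 : ∀ k : (Fin N → Space ν) → ℂ, ∫ x, (0 : L2 ν (Fin N)) x * k x = 0 := fun k => by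
      refine integral_eq_zero_of_ae ?_
      filter_upwards [hz] with x hx
      simp
    have e3 : ∫ x, (potential U V x : ℂ) * (0 : L2 ν (Fin N)) x * (g x : ℂ) = 0 := by
      refine integral_eq_zero_of_ae ?_
      filter_upwards [hz] with x hx
      simp
    simp only at h1
    rw [e2, e3, add_zero] at h1
    rw [← h1]
    refine integral_congr_ae (Filter.Eventually.of_forall fun x => ?_)
    simp [mul_comm]
  rw [h]
  rfl

end Hamiltonian

section Dynamics

variable {𝓗 : Type*} [NormedAddCommGroup 𝓗] [InnerProductSpace ℂ 𝓗]

/-- `W t = e^{-iHt}`: `W` is the strongly continuous one-parameter unitary group on `𝓗` whose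
generator is exactly `H`, that is, `ψ ∈ D(H)` and `H ψ = χ` if and only if `t ↦ W t ψ` is
differentiable at `0` with derivative `-i χ`. -/
structure IsUnitaryGroup (H : 𝓗 →ₗ.[ℂ] 𝓗) (W : ℝ → 𝓗 →L[ℂ] 𝓗) : Prop where
  zero : W 0 = 1
  add : ∀ s t, W (s + t) = W s * W t
  norm_map : ∀ t ψ, ‖W t ψ‖ = ‖ψ‖
  continuous : ∀ ψ, Continuous fun t => W t ψ
  generator : ∀ ψ χ, (ψ, χ) ∈ H.graph ↔ HasDerivAt (fun t => W t ψ) (-Complex.I • χ) 0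

open Classical in
/-- The unitary operator `e^{-iHt}`. For self-adjoint `H` the group exists (Stone's theorem) and is
unique; the value `0` is a placeholder for operators that generate no unitary group. -/
def expNegI (H : 𝓗 →ₗ.[ℂ] 𝓗) (t : ℝ) : 𝓗 →L[ℂ] 𝓗 :=
  if h : ∃ W, IsUnitaryGroup H W then h.choose t else 0

end Dynamics

end MeanField
end

open MeanField

/-! Write `τ_t(x) = e^{iHt} x e^{-iHt}` with `H = H_N`, and let `a`, `b` be the operators `A`, `B`
placed on the particles `i`, `j`. Conjugating by the unitaries, it suffices to bound `[τ_t(a), b]`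
for both signs of `t`.

Subtract from `H` the bounded operator `Q`, the interaction of all pairs that meet `i`. Under `H' =
H - Q` the particles `i` decouple: `a` evolves into another operator on the same particles
(`conj_onParticles_eq`), which commutes with `b`. Comparing the two dynamics through `e^{iHs}
e^{-iH's}` gives, in Duhamel form, `‖[τ_t(a), b]‖ ≤ 2‖A‖ ∫₀^t ‖[τ_s(Q), b]‖ ds` for `t ≥ 0`
(`norm_lie_evolution_le`).

At most `mn` pairs in `Q` also meet `j`, and they get the trivial bound `2‖V‖‖B‖`. The others, at
most `mN`, are two-particle operators away from `j`, so the same inequality applies to them again.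
With the prefactor `1/N` (`norm_lie_conj_pairSum_le`), a bound of the form `(m‖A‖/2) f(t)`
reproduces itself under `f' = 4‖V‖ (2n‖B‖/N + f)`; the 4 is a 2 from the commutator times the 2
particles of a pair. Starting from the trivial bound, the iterates are `(2n‖B‖/N)(e^{4‖V‖t} - 1)`
plus a remainder `2‖B‖(4‖V‖t)^p/p!` that tends to zero.

Since `H` is unbounded, all derivatives are strong ones. The only domain information used about
`H_N`, beyond self-adjointness, is that products of domain vectors of `H₁` lie in its domain, with
the expected action (`prodState_mem_graph`). They are total, and products such as `e^{iHs}
e^{-iH's}` have bounded derivatives, so formulas on a total set extend to all vectors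
(`IsUnitaryGroup.hasDerivAt_wave`). The free dynamics enters only as the tensor power of
`e^{-iH₁t}`, so self-adjointness of the free `N`-particle operator is never needed. Stone's theorem
(`exists_isUnitaryGroup`) supplies the groups of `H₁`, `H_N` and `H'`. -/

open MeasureTheory
open scoped ContDiff TensorProduct Laplacian

noncomputable section

namespace MeanField

/-! ### Calculus for strongly differentiable families of operators -/

section StrongCalculus

open Filter Topology

variable {E F : Type*} [NormedAddCommGroup E] [NormedSpace ℂ E] [NormedAddCommGroup F]
  [NormedSpace ℂ F]

theorem clm_map_real_smul (T : E →L[ℂ] F) (r : ℝ) (x : E) : T (r • x) = r • T x :=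
  (T.toLinearMap.restrictScalars ℝ).map_smul r x

/-- The product rule for a strongly differentiable operator family applied to a curve. -/
theorem hasDerivAt_clm_apply_of_strong {T : ℝ → E →L[ℂ] F} {C : ℝ} (hC : ∀ r, ‖T r‖ ≤ C)
    {v : ℝ → E} {v' : E} {w : F} {s : ℝ} (hT : HasDerivAt (fun r => T r (v s)) w s)
    (hc : ContinuousAt (fun r => T r v') s) (hv : HasDerivAt v v' s) :
    HasDerivAt (fun r => T r (v r)) (w + T s v') s := by
  rw [hasDerivAt_iff_isLittleO] at *
  have h1 : (fun r => T r (v r - v s - (r - s) • v')) =o[𝓝 s] fun r => r - s := by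
    refine Asymptotics.IsBigO.trans_isLittleO (Asymptotics.IsBigO.of_bound C ?_) hv
    exact Eventually.of_forall fun r => (T r).le_of_opNorm_le (hC r) _
  have h2 : (fun r => (r - s) • (T r v' - T s v')) =o[𝓝 s] fun r => r - s := by
    have : (fun r => T r v' - T s v') =o[𝓝 s] fun _ => (1 : ℝ) := by
      rw [Asymptotics.isLittleO_one_iff]
      have := hc.tendsto.sub_const (T s v')
      rwa [sub_self] at this
    simpa using (Asymptotics.isBigO_refl (fun r : ℝ => r - s) (𝓝 s)).smul_isLittleO this
  -- The error splits into that of `T r` on the frozen vector `v s`, `T r` applied to the error of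
  -- `v`, and `(r - s)(T r v' - T s v')`. Only strong continuity and the uniform bound enter, as
  -- operator-norm derivatives need not exist.
  refine ((hT.add h1).add h2).congr_left fun r => ?_
  simp only [map_sub, clm_map_real_smul, smul_sub, smul_add]
  abel

/-- The inverse of a strongly differentiable operator family is strongly differentiable. -/
theorem hasDerivAt_inverse_apply {T S : ℝ → E →L[ℂ] E} {C : ℝ} (hC : ∀ r, ‖S r‖ ≤ C)
    (hST : ∀ r, S r * T r = 1) (hTS : ∀ r, T r * S r = 1) {s : ℝ} {ψ w : E}
    (hT : HasDerivAt (fun r => T r (S s ψ)) w s) (hc : ContinuousAt (fun r => S r w) s) :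
    HasDerivAt (fun r => S r ψ) (-S s w) s := by
  rw [hasDerivAt_iff_isLittleO] at *
  have h1 : (fun r => S r (T r (S s ψ) - T s (S s ψ) - (r - s) • w)) =o[𝓝 s] fun r => r - s := by
    refine Asymptotics.IsBigO.trans_isLittleO (Asymptotics.IsBigO.of_bound C ?_) hT
    exact Eventually.of_forall fun r => (S r).le_of_opNorm_le (hC r) _
  have h2 : (fun r => (r - s) • (S r w - S s w)) =o[𝓝 s] fun r => r - s := by
    have : (fun r => S r w - S s w) =o[𝓝 s] fun _ => (1 : ℝ) := by
      rw [Asymptotics.isLittleO_one_iff]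
      have := hc.tendsto.sub_const (S s w)
      rwa [sub_self] at this
    simpa using (Asymptotics.isBigO_refl (fun r : ℝ => r - s) (𝓝 s)).smul_isLittleO this
  -- With `φ = S s ψ` one has `S r ψ - S s ψ = -S r (T r φ - T s φ)`.
  refine ((h1.add h2).neg_left).congr_left fun r => ?_
  have e1 : ∀ φ, S r (T r φ) = φ := fun φ => DFunLike.congr_fun (hST r) φ
  have e2 : T s (S s ψ) = ψ := DFunLike.congr_fun (hTS s) ψ
  simp only [map_sub, clm_map_real_smul, smul_sub, smul_neg, e1, e2]
  abel

/-- Strong differentiability on a set with dense span extends to all vectors. -/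
theorem hasDerivAt_apply_of_dense {T T' : ℝ → E →L[ℂ] F} {C C' : ℝ} (hC : ∀ r, ‖T r‖ ≤ C)
    (hC' : ∀ r, ‖T' r‖ ≤ C') {D : Set E} (hD : Dense (Submodule.span ℂ D : Set E))
    (h : ∀ ψ ∈ D, ∀ s, HasDerivAt (fun r => T r ψ) (T' s ψ) s) (ψ : E) (s : ℝ) :
    HasDerivAt (fun r => T r ψ) (T' s ψ) s := by
  have h' : ∀ ψ ∈ Submodule.span ℂ D, ∀ s, HasDerivAt (fun r => T r ψ) (T' s ψ) s := by
    intro ψ hψ s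
    induction hψ using Submodule.span_induction with
    | mem x hx => exact h x hx s
    | zero => simpa using hasDerivAt_const s (0 : F)
    | add x y _ _ hx hy => simpa using hx.fun_add hy
    | smul a x _ hx => simpa using hx.fun_const_smul a
  obtain ⟨u, hu, hlim⟩ := mem_closure_iff_seq_limit.1 (hD ψ)
  -- The uniform norm bounds make the approximation uniform in `r`, for the family and for its
  -- derivative, so limit and derivative may be exchanged.
  have key : ∀ {A : ℝ → E →L[ℂ] F} {c : ℝ}, (∀ r, ‖A r‖ ≤ c) →
      TendstoUniformly (fun n r => A r (u n)) (fun r => A r ψ) atTop := by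
    intro A c hA
    rw [Metric.tendstoUniformly_iff]
    intro ε hε
    have h1 : Tendsto (fun n => c * ‖ψ - u n‖) atTop (𝓝 0) := by
      have := (tendsto_const_nhds (x := ψ)).sub hlim
      simpa using this.norm.const_mul c
    filter_upwards [h1.eventually (gt_mem_nhds hε)] with n hn r
    rw [dist_eq_norm, ← map_sub]
    exact ((A r).le_of_opNorm_le (hA r) _).trans_lt hn
  exact hasDerivAt_of_tendstoUniformly (key hC') (Eventually.of_forall fun n r => h' _ (hu n) r)
    (fun r => (key hC).tendsto_at r) s

/-- Strong continuity on a set with dense span extends to all vectors. -/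
theorem continuous_apply_of_dense {T : ℝ → E →L[ℂ] F} {C : ℝ} (hC : ∀ r, ‖T r‖ ≤ C)
    {D : Set E} (hD : Dense (Submodule.span ℂ D : Set E))
    (h : ∀ ψ ∈ D, Continuous fun r => T r ψ) (ψ : E) : Continuous fun r => T r ψ := by
  have h' : ∀ ψ ∈ Submodule.span ℂ D, Continuous fun r => T r ψ := by
    intro ψ hψ
    induction hψ using Submodule.span_induction with
    | mem x hx => exact h x hx
    | zero => simpa using continuous_const
    | add x y _ _ hx hy => simpa using hx.fun_add hy
    | smul a x _ hx => simpa using hx.fun_const_smul a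
  obtain ⟨u, hu, hlim⟩ := mem_closure_iff_seq_limit.1 (hD ψ)
  have key : TendstoUniformly (fun n r => T r (u n)) (fun r => T r ψ) atTop := by
    rw [Metric.tendstoUniformly_iff]
    intro ε hε
    have h1 : Tendsto (fun n => C * ‖ψ - u n‖) atTop (𝓝 0) := by
      have := (tendsto_const_nhds (x := ψ)).sub hlim
      simpa using this.norm.const_mul C
    filter_upwards [h1.eventually (gt_mem_nhds hε)] with n hn r
    rw [dist_eq_norm, ← map_sub]
    exact ((T r).le_of_opNorm_le (hC r) _).trans_lt hn
  exact key.continuous (Frequently.of_forall fun n => h' _ (hu n))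

/-- A uniformly bounded strongly continuous family maps continuous curves to continuous curves. -/
theorem continuous_clm_apply_of_strong {T : ℝ → E →L[ℂ] F} {C : ℝ} (hC : ∀ r, ‖T r‖ ≤ C)
    (hT : ∀ ψ, Continuous fun r => T r ψ) {v : ℝ → E} (hv : Continuous v) :
    Continuous fun r => T r (v r) := by
  rw [continuous_iff_continuousAt]
  intro s
  have h1 : Tendsto (fun r => T r (v r - v s)) (𝓝 s) (𝓝 0) := by
    refine squeeze_zero_norm (a := fun r => C * ‖v r - v s‖)
      (fun r => (T r).le_of_opNorm_le (hC r) _) ?_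
    have := (hv.tendsto s).sub_const (v s)
    simpa using this.norm.const_mul C
  have h2 := h1.add ((hT (v s)).tendsto s)
  rw [zero_add] at h2
  refine h2.congr fun r => ?_
  rw [map_sub]
  abel

end StrongCalculus

/-! ### Unitary groups and wave operators -/

section UnitaryGroup

variable {𝓗 : Type*} [NormedAddCommGroup 𝓗] [InnerProductSpace ℂ 𝓗]
  {H : 𝓗 →ₗ.[ℂ] 𝓗} {W : ℝ → 𝓗 →L[ℂ] 𝓗}

theorem norm_le_one_of_norm_map {T : 𝓗 →L[ℂ] 𝓗} (h : ∀ ψ, ‖T ψ‖ = ‖ψ‖) : ‖T‖ ≤ 1 :=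
  T.opNorm_le_bound zero_le_one fun ψ => by rw [h, one_mul]

theorem IsUnitaryGroup.norm_le (hW : IsUnitaryGroup H W) (t : ℝ) : ‖W t‖ ≤ 1 :=
  norm_le_one_of_norm_map (hW.norm_map t)

theorem IsUnitaryGroup.mul_neg (hW : IsUnitaryGroup H W) (t : ℝ) : W t * W (-t) = 1 := by
  rw [← hW.add, add_neg_cancel, hW.zero]

theorem IsUnitaryGroup.neg_mul (hW : IsUnitaryGroup H W) (t : ℝ) : W (-t) * W t = 1 := by
  rw [← hW.add, neg_add_cancel, hW.zero]

theorem IsUnitaryGroup.hasDerivAt (hW : IsUnitaryGroup H W) {ψ χ : 𝓗} (h : (ψ, χ) ∈ H.graph)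
    (t : ℝ) : HasDerivAt (fun s => W s ψ) (-Complex.I • W t χ) t := by
  have h0 := (hW.generator ψ χ).1 h
  have h1 : HasDerivAt (fun s => W (s - t) ψ) (-Complex.I • χ) t :=
    HasDerivAt.comp_sub_const (f := fun s => W s ψ) t t (by rwa [sub_self])
  have h2 := ((W t).restrictScalars ℝ).hasFDerivAt.comp_hasDerivAt t h1
  simp only [Function.comp_def, ContinuousLinearMap.coe_restrictScalars', map_smul] at h2
  refine h2.congr_of_eventuallyEq (Filter.Eventually.of_forall fun s => ?_)
  change W s ψ = (W t * W (s - t)) ψ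
  rw [← hW.add]
  congr 2
  ring

theorem IsUnitaryGroup.mem_graph (hW : IsUnitaryGroup H W) {ψ χ : 𝓗} (h : (ψ, χ) ∈ H.graph)
    (t : ℝ) : (W t ψ, W t χ) ∈ H.graph := by
  rw [hW.generator]
  have h2 := ((W t).restrictScalars ℝ).hasFDerivAt.comp_hasDerivAt 0 ((hW.generator ψ χ).1 h)
  simp only [Function.comp_def, ContinuousLinearMap.coe_restrictScalars', map_smul] at h2
  refine h2.congr_of_eventuallyEq (Filter.Eventually.of_forall fun s => ?_)
  change (W s * W t) ψ = (W t * W s) ψ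
  rw [← hW.add, ← hW.add, add_comm]

/-- The derivative of `e^{iHs} W' s` for an evolution `W'` which is generated on a total set by
`H - Q` with a bounded operator `Q`. -/
theorem IsUnitaryGroup.hasDerivAt_wave (hW : IsUnitaryGroup H W) {W' : ℝ → 𝓗 →L[ℂ] 𝓗}
    (hW' : ∀ s, ‖W' s‖ ≤ 1) (Q : 𝓗 →L[ℂ] 𝓗) {D : Set 𝓗}
    (hD : Dense (Submodule.span ℂ D : Set 𝓗))
    (h : ∀ ψ ∈ D, ∀ s, ∃ χ, HasDerivAt (fun r => W' r ψ) (-Complex.I • χ) s ∧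
      (W' s ψ, χ + Q (W' s ψ)) ∈ H.graph) (ψ : 𝓗) (s : ℝ) :
    HasDerivAt (fun r => (W (-r) * W' r) ψ) ((Complex.I • (W (-s) * Q * W' s)) ψ) s := by
  -- The unbounded parts of the two generators cancel and only `Q` survives. The derivative is
  -- therefore bounded by `‖Q‖`, and a total set suffices.
  refine hasDerivAt_apply_of_dense (C := 1) (C' := ‖Q‖) (T := fun r => W (-r) * W' r)
    (T' := fun r => Complex.I • (W (-r) * Q * W' r)) (fun r => ?_) (fun r => ?_) hD ?_ ψ s
  · exact (norm_mul_le _ _).trans (mul_le_one₀ (hW.norm_le _) (norm_nonneg _) (hW' _))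
  · rw [norm_smul, Complex.norm_I, one_mul]
    calc ‖W (-r) * Q * W' r‖ ≤ ‖W (-r)‖ * ‖Q‖ * ‖W' r‖ := norm_mul₃_le
      _ ≤ 1 * ‖Q‖ * 1 := by
        gcongr
        · exact hW.norm_le _
        · exact hW' _
      _ = ‖Q‖ := by ring
  · intro ψ hψ s
    obtain ⟨χ, h1, h2⟩ := h ψ hψ s
    have h3 : HasDerivAt (fun r => W (-r) (W' s ψ))
        (-(-Complex.I • W (-s) (χ + Q (W' s ψ)))) s := by
      have := HasDerivAt.scomp s (hW.hasDerivAt h2 (-s)) (hasDerivAt_neg s)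
      rwa [neg_one_smul] at this
    have h4 := hasDerivAt_clm_apply_of_strong (T := fun r => W (-r)) (C := 1)
      (fun r => hW.norm_le _) h3
      (((hW.continuous (-Complex.I • χ)).comp continuous_neg).continuousAt) h1
    refine h4.congr_deriv ?_
    rw [map_smul, map_add]
    change _ = Complex.I • W (-s) (Q (W' s ψ))
    module

end UnitaryGroup

/-! ### Self-adjoint operators through their graphs: bounded perturbations and resolvents -/

section SelfAdjoint

variable {𝓗 : Type*} [NormedAddCommGroup 𝓗] [InnerProductSpace ℂ 𝓗] [CompleteSpace 𝓗]
  {H : 𝓗 →ₗ.[ℂ] 𝓗}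

/-- The graph equals its own adjoint. This gives a weak test for membership that replaces arguments
with domains in what follows. -/
theorem mem_graph_iff_of_isSelfAdjoint (hH : IsSelfAdjoint H) {ψ χ : 𝓗} :
    (ψ, χ) ∈ H.graph ↔ ∀ a b, (a, b) ∈ H.graph → inner ℂ b ψ = inner ℂ a χ := by
  have h := LinearPMap.adjoint_graph_eq_graph_adjoint hH.dense_domain
  rw [LinearPMap.isSelfAdjoint_def.1 hH] at h
  conv_lhs => rw [h]
  rw [Submodule.mem_adjoint_iff]
  simp only [sub_eq_zero]

theorem inner_eq_of_mem_graph (hH : IsSelfAdjoint H) {a b ψ χ : 𝓗} (h : (a, b) ∈ H.graph)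
    (h' : (ψ, χ) ∈ H.graph) : inner ℂ b ψ = inner ℂ a χ :=
  (mem_graph_iff_of_isSelfAdjoint hH).1 h' a b h

theorem dense_fst_graph (hH : IsSelfAdjoint H) : Dense {ψ : 𝓗 | ∃ χ, (ψ, χ) ∈ H.graph} := by
  refine hH.dense_domain.mono fun x hx => ⟨H ⟨x, hx⟩, H.mem_graph ⟨x, hx⟩⟩

/-- A self-adjoint operator stays self-adjoint if a bounded symmetric operator is subtracted. -/
theorem exists_isSelfAdjoint_sub (hH : IsSelfAdjoint H) (Q : 𝓗 →L[ℂ] 𝓗)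
    (hQ : ∀ x y, inner ℂ (Q x) y = inner ℂ x (Q y)) :
    ∃ H' : 𝓗 →ₗ.[ℂ] 𝓗, IsSelfAdjoint H' ∧
      ∀ ψ χ, (ψ, χ) ∈ H'.graph ↔ (ψ, χ + Q ψ) ∈ H.graph := by
  let G : Submodule ℂ (𝓗 × 𝓗) := H.graph.comap
    (LinearMap.prod (LinearMap.fst ℂ 𝓗 𝓗) (LinearMap.snd ℂ 𝓗 𝓗 + Q.toLinearMap ∘ₗ
      LinearMap.fst ℂ 𝓗 𝓗))
  have hG : ∀ ψ χ, (ψ, χ) ∈ G ↔ (ψ, χ + Q ψ) ∈ H.graph := fun ψ χ => Iff.rfl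
  have hgr : G.toLinearPMap.graph = G := by
    refine Submodule.toLinearPMap_graph_eq _ ?_
    rintro ⟨ψ, χ⟩ h (rfl : ψ = 0)
    have h1 := (hG _ _).1 h
    rw [map_zero, add_zero] at h1
    exact H.graph_fst_eq_zero_snd h1 rfl
  have hd : Dense (G.toLinearPMap.domain : Set 𝓗) := by
    refine (dense_fst_graph hH).mono ?_
    rintro ψ ⟨χ, h⟩
    refine LinearPMap.mem_domain_of_mem_graph (y := χ - Q ψ) ?_
    rw [hgr, hG, sub_add_cancel]
    exact h
  refine ⟨G.toLinearPMap, ?_, fun ψ χ => by rw [hgr, hG]⟩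
  rw [LinearPMap.isSelfAdjoint_def]
  refine LinearPMap.eq_of_eq_graph ?_
  rw [LinearPMap.adjoint_graph_eq_graph_adjoint hd, hgr]
  ext ⟨ψ, χ⟩
  rw [Submodule.mem_adjoint_iff, hG, mem_graph_iff_of_isSelfAdjoint hH]
  simp only [sub_eq_zero]
  constructor
  · intro h a b hab
    have := h a (b - Q a) (by rw [hG, sub_add_cancel]; exact hab)
    rw [inner_sub_left, hQ, sub_eq_iff_eq_add] at this
    rw [this, inner_add_right]
  · intro h a b hab
    have := h a _ ((hG _ _).1 hab)
    rw [inner_add_left, inner_add_right, hQ] at this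
    exact add_right_cancel this

/-- The cross term vanishes because `⟨χ, ψ⟩` is real. Hence `H - ic` is bounded below for `c ≠ 0`.
-/
theorem norm_sub_smul_sq (hH : IsSelfAdjoint H) {ψ χ : 𝓗} (h : (ψ, χ) ∈ H.graph) (c : ℝ) :
    ‖χ - (Complex.I * c) • ψ‖ ^ 2 = ‖χ‖ ^ 2 + c ^ 2 * ‖ψ‖ ^ 2 := by
  have h1 := inner_eq_of_mem_graph hH h h
  have h2 : RCLike.re (inner ℂ χ ((Complex.I * c) • ψ)) = 0 := by
    have h3 : (inner ℂ χ ψ).im = 0 := by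
      have h4 := inner_conj_symm (𝕜 := ℂ) χ ψ
      rw [← h1] at h4
      exact Complex.conj_eq_iff_im.1 h4
    rw [inner_smul_right]
    simp [h3]
  rw [norm_sub_sq (𝕜 := ℂ), h2, norm_smul]
  simp [mul_pow]

/-- The resolvent `(H - i c)⁻¹` of a self-adjoint operator at `i c`, `c ≠ 0`. -/
theorem exists_resolvent (hH : IsSelfAdjoint H) {c : ℝ} (hc : c ≠ 0) :
    ∃ R : 𝓗 →L[ℂ] 𝓗, (∀ φ, (R φ, φ + (Complex.I * c) • R φ) ∈ H.graph) ∧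
      (∀ ψ χ, (ψ, χ) ∈ H.graph → R (χ - (Complex.I * c) • ψ) = ψ) ∧
      ∀ φ, |c| * ‖R φ‖ ≤ ‖φ‖ := by
  have hcl : IsClosed (H.graph : Set (𝓗 × 𝓗)) := hH.isClosed
  let T : H.graph →L[ℂ] 𝓗 := (ContinuousLinearMap.snd ℂ 𝓗 𝓗 -
    (Complex.I * c) • ContinuousLinearMap.fst ℂ 𝓗 𝓗).comp H.graph.subtypeL
  have hT : ∀ p : H.graph, T p = p.1.2 - (Complex.I * c) • p.1.1 := fun p => rfl
  have hTn : ∀ p : H.graph, ‖T p‖ ^ 2 = ‖p.1.2‖ ^ 2 + c ^ 2 * ‖p.1.1‖ ^ 2 := fun p => by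
    rw [hT]
    exact norm_sub_smul_sq hH p.2 c
  have hT1 : ∀ p : H.graph, |c| * ‖p.1.1‖ ≤ ‖T p‖ := fun p => by
    refine abs_le_of_sq_le_sq' ?_ (norm_nonneg _) |>.2
    rw [hTn, mul_pow, sq_abs]
    nlinarith [sq_nonneg ‖p.1.2‖]
  have hT2 : ∀ p : H.graph, ‖p.1.2‖ ≤ ‖T p‖ := fun p => by
    refine abs_le_of_sq_le_sq' ?_ (norm_nonneg _) |>.2
    rw [hTn]
    nlinarith [sq_nonneg (c * ‖p.1.1‖)]
  have hc' : 0 < |c| := abs_pos.2 hc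
  -- `H - ic`, viewed as a bounded map on the complete graph, is bounded below, so its range is
  -- closed.
  have hanti : AntilipschitzWith (Real.toNNReal (|c|⁻¹ + 1)) T := by
    refine ContinuousLinearMap.antilipschitz_of_bound T fun p => ?_
    rw [Real.coe_toNNReal _ (by positivity), add_mul, one_mul]
    refine max_le ?_ ?_
    · have := hT1 p
      rw [← le_inv_mul_iff₀ hc'] at this
      exact this.trans (le_add_of_nonneg_right (norm_nonneg _))
    · exact (hT2 p).trans (le_add_of_nonneg_left (by positivity))
  have hcomp : CompleteSpace H.graph := hcl.completeSpace_coe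
  have hrcl : IsClosed (LinearMap.range T.toLinearMap : Set 𝓗) := by
    rw [LinearMap.coe_range]
    exact hanti.isClosed_range T.uniformContinuous
  have hrange : LinearMap.range T.toLinearMap = ⊤ := by
    have : CompleteSpace (LinearMap.range T.toLinearMap) := hrcl.completeSpace_coe
    rw [← Submodule.orthogonal_eq_bot_iff, Submodule.eq_bot_iff]
    intro φ hφ
    -- A vector orthogonal to the range would satisfy `Hφ = -icφ`; a symmetric operator has no
    -- nonreal eigenvalue, so `φ = 0`.
    have h1 : (φ, -(Complex.I * c) • φ) ∈ H.graph := by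
      rw [mem_graph_iff_of_isSelfAdjoint hH]
      intro a b hab
      have h2 := (Submodule.mem_orthogonal _ _).1 hφ (T ⟨(a, b), hab⟩) ⟨_, rfl⟩
      rw [hT, inner_sub_left, inner_smul_left, sub_eq_zero] at h2
      rw [h2, inner_smul_right]
      simp
    have h3 := inner_eq_of_mem_graph hH h1 h1
    rw [inner_smul_left, inner_smul_right, ← sub_eq_zero, ← sub_mul, mul_eq_zero] at h3
    rcases h3 with h3 | h3
    · simp only [map_neg, map_mul, Complex.conj_I, Complex.conj_ofReal] at h3
      have h4 : (2 * Complex.I) * (c : ℂ) = 0 := by linear_combination h3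
      simp [hc] at h4
    · exact inner_self_eq_zero.1 h3
  let e := ContinuousLinearEquiv.ofBijective T
    (LinearMap.ker_eq_bot.2 hanti.injective) hrange
  have he : ∀ p, e p = T p := fun p => rfl
  refine ⟨(ContinuousLinearMap.fst ℂ 𝓗 𝓗).comp (H.graph.subtypeL.comp e.symm.toContinuousLinearMap),
    fun φ => ?_, fun ψ χ h => ?_, fun φ => ?_⟩
  · have h1 : T (e.symm φ) = φ := e.apply_symm_apply φ
    rw [hT, sub_eq_iff_eq_add] at h1
    have h2 := (e.symm φ).2
    have h3 : ((e.symm φ).1.1, φ + (Complex.I * c) • (e.symm φ).1.1) = (e.symm φ).1 :=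
      Prod.ext rfl h1.symm
    change ((e.symm φ).1.1, φ + (Complex.I * c) • (e.symm φ).1.1) ∈ H.graph
    rw [h3]
    exact h2
  · change (e.symm (T ⟨(ψ, χ), h⟩)).1.1 = ψ
    rw [← he, e.symm_apply_apply]
  · have h1 : T (e.symm φ) = φ := e.apply_symm_apply φ
    have := hT1 (e.symm φ)
    rw [h1] at this
    exact this

end SelfAdjoint

/-! ### Stone's theorem by Yosida approximation -/

section Stone

open Filter Topology

variable {𝓗 : Type*} [NormedAddCommGroup 𝓗] [InnerProductSpace ℂ 𝓗]

/-- Pointwise convergence of uniformly bounded operators follows from convergence on a dense set. -/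
theorem tendsto_clm_apply_of_dense {T : ℕ → 𝓗 →L[ℂ] 𝓗} {C : ℝ} (hC : ∀ n, ‖T n‖ ≤ C)
    {D : Set 𝓗} (hD : Dense D) (h : ∀ ψ ∈ D, Tendsto (fun n => T n ψ) atTop (𝓝 0)) (ψ : 𝓗) :
    Tendsto (fun n => T n ψ) atTop (𝓝 0) := by
  have hC0 : 0 ≤ C := (norm_nonneg _).trans (hC 0)
  rw [Metric.tendsto_atTop]
  intro ε hε
  obtain ⟨φ, hφ, hd⟩ := hD.exists_dist_lt ψ (ε := ε / (2 * (C + 1))) (by positivity)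
  obtain ⟨N, hN⟩ := Metric.tendsto_atTop.1 (h φ hφ) (ε / 2) (by positivity)
  refine ⟨N, fun n hn => ?_⟩
  have h1 := hN n hn
  rw [dist_zero_right] at h1 ⊢
  have h2 : ‖T n (ψ - φ)‖ ≤ C * ‖ψ - φ‖ := (T n).le_of_opNorm_le (hC n) _
  rw [dist_eq_norm, lt_div_iff₀ (by positivity)] at hd
  have h3 : T n ψ = T n (ψ - φ) + T n φ := by rw [map_sub]; abel
  rw [h3]
  refine (norm_add_le _ _).trans_lt ?_
  nlinarith [norm_nonneg (ψ - φ)]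

variable [CompleteSpace 𝓗]

/-- The unitary group `e^{-iKt}` of a bounded operator. -/
def boundedGroup (K : 𝓗 →L[ℂ] 𝓗) (t : ℝ) : 𝓗 →L[ℂ] 𝓗 :=
  NormedSpace.exp (t • (-Complex.I • K))

theorem boundedGroup_zero (K : 𝓗 →L[ℂ] 𝓗) : boundedGroup K 0 = 1 := by
  simp [boundedGroup]

theorem boundedGroup_add (K : 𝓗 →L[ℂ] 𝓗) (s t : ℝ) :
    boundedGroup K (s + t) = boundedGroup K s * boundedGroup K t := by
  let +nondep : NormedAlgebra ℚ (𝓗 →L[ℂ] 𝓗) := .restrictScalars ℚ ℂ _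
  rw [boundedGroup, add_smul, NormedSpace.exp_add_of_commute]
  · rfl
  · exact ((Commute.refl _).smul_left _).smul_right _

theorem boundedGroup_sub {K L : 𝓗 →L[ℂ] 𝓗} (h : Commute K L) (t : ℝ) :
    boundedGroup K t = boundedGroup L t * boundedGroup (K - L) t := by
  have h1 : Commute (t • -Complex.I • L) (t • -Complex.I • (K - L)) := by
    have h2 : L * (K - L) = (K - L) * L := by rw [mul_sub, sub_mul, h.eq]
    ext ψ
    have h3 := DFunLike.congr_fun h2 ψ
    simp only [mul_apply_eq_comp, smul_apply, map_smul, clm_map_real_smul] at h3 ⊢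
    rw [h3]
  have h4 : t • -Complex.I • K = t • -Complex.I • L + t • -Complex.I • (K - L) := by
    rw [← smul_add, ← smul_add, add_sub_cancel]
  let +nondep : NormedAlgebra ℚ (𝓗 →L[ℂ] 𝓗) := .restrictScalars ℚ ℂ _
  unfold boundedGroup
  rw [h4]
  exact NormedSpace.exp_add_of_commute h1

theorem norm_boundedGroup_apply {K : 𝓗 →L[ℂ] 𝓗} (hK : IsSelfAdjoint K) (t : ℝ) (ψ : 𝓗) :
    ‖boundedGroup K t ψ‖ = ‖ψ‖ := by
  have h1 : Complex.I • (-(t : ℂ) • K) = t • -Complex.I • K := by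
    rw [← Complex.coe_smul, smul_smul, smul_smul]
    congr 1
    ring
  have h2 : IsSelfAdjoint (-(t : ℂ) • K) :=
    IsSelfAdjoint.smul (by simp [isSelfAdjoint_iff]) hK
  have h3 := (selfAdjoint.expUnitary (⟨-(t : ℂ) • K, h2⟩ : selfAdjoint (𝓗 →L[ℂ] 𝓗))).2
  have h4 : boundedGroup K t ∈ unitary (𝓗 →L[ℂ] 𝓗) := by
    rw [selfAdjoint.expUnitary_coe, h1] at h3
    exact h3
  exact ContinuousLinearMap.norm_map_of_mem_unitary h4 ψ

theorem hasDerivAt_boundedGroup (K : 𝓗 →L[ℂ] 𝓗) (ψ : 𝓗) (t : ℝ) :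
    HasDerivAt (fun s => boundedGroup K s ψ) (-Complex.I • boundedGroup K t (K ψ)) t := by
  have h := hasDerivAt_exp_smul_const (𝕂 := ℝ) (-Complex.I • K) t
  have h2 := ((ContinuousLinearMap.apply ℂ 𝓗 ψ).restrictScalars ℝ).hasFDerivAt.comp_hasDerivAt t h
  refine h2.congr_deriv ?_
  change NormedSpace.exp (t • (-Complex.I • K)) (-Complex.I • K ψ) = _
  rw [map_smul]
  rfl

theorem norm_boundedGroup_sub_le {K : 𝓗 →L[ℂ] 𝓗} (hK : IsSelfAdjoint K) (t : ℝ) (ψ : 𝓗) :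
    ‖boundedGroup K t ψ - ψ‖ ≤ |t| * ‖K ψ‖ := by
  have h := convex_univ.norm_image_sub_le_of_norm_hasDerivWithin_le (𝕜 := ℝ) (C := ‖K ψ‖)
    (f := fun s => boundedGroup K s ψ) (x := 0) (y := t)
    (fun s _ => (hasDerivAt_boundedGroup K ψ s).hasDerivWithinAt)
    (fun s _ => by rw [norm_smul, norm_boundedGroup_apply hK]; simp) trivial trivial
  simpa [boundedGroup_zero, mul_comm] using h

/-- For commuting generators the isometry `e^{-iLt}` factors out and leaves `e^{-i(K-L)t} - 1`. This
yields the Cauchy property of the approximating groups on the domain of `H`. -/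
theorem norm_boundedGroup_sub_boundedGroup_le {K L : 𝓗 →L[ℂ] 𝓗} (hK : IsSelfAdjoint K)
    (hL : IsSelfAdjoint L) (h : Commute K L) (t : ℝ) (ψ : 𝓗) :
    ‖boundedGroup K t ψ - boundedGroup L t ψ‖ ≤ |t| * ‖K ψ - L ψ‖ := by
  rw [boundedGroup_sub h t, mul_apply_eq_comp, ← map_sub, norm_boundedGroup_apply hL]
  exact norm_boundedGroup_sub_le (hK.sub hL) t ψ

/-- A first-order Taylor bound that survives the limit of the approximations. There `Hψ` need not
lie in the domain of `H`, so it is compared with a nearby domain vector `φ` instead of using `‖K (K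
ψ)‖`. -/
theorem norm_boundedGroup_sub_linear_le {K : 𝓗 →L[ℂ] 𝓗} (hK : IsSelfAdjoint K) (t : ℝ)
    (ψ φ : 𝓗) : ‖boundedGroup K t ψ - ψ - t • (-Complex.I • K ψ)‖ ≤
      (2 * ‖K ψ - φ‖ + |t| * ‖K φ‖) * |t| := by
  have hd : ∀ s, HasDerivAt (fun s => boundedGroup K s ψ - s • (-Complex.I • K ψ))
      (-Complex.I • boundedGroup K s (K ψ) - -Complex.I • K ψ) s := fun s => by
    simpa using (hasDerivAt_boundedGroup K ψ s).fun_sub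
      ((hasDerivAt_id' s).smul_const (-Complex.I • K ψ))
  have hb : ∀ s ∈ Set.uIcc 0 t, ‖-Complex.I • boundedGroup K s (K ψ) - -Complex.I • K ψ‖ ≤
      2 * ‖K ψ - φ‖ + |t| * ‖K φ‖ := by
    intro s hs
    have hs' : |s| ≤ |t| := by simpa using Set.abs_sub_left_of_mem_uIcc hs
    rw [← smul_sub, norm_smul, norm_neg, Complex.norm_I, one_mul]
    have e : boundedGroup K s (K ψ) - K ψ = boundedGroup K s (K ψ - φ) +
        (boundedGroup K s φ - φ) - (K ψ - φ) := by
      rw [map_sub]; abel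
    rw [e]
    refine (norm_sub_le _ _).trans ?_
    have h1 := norm_add_le (boundedGroup K s (K ψ - φ)) (boundedGroup K s φ - φ)
    rw [norm_boundedGroup_apply hK] at h1
    have h2 := norm_boundedGroup_sub_le hK s φ
    have h3 : |s| * ‖K φ‖ ≤ |t| * ‖K φ‖ := by gcongr
    linarith
  have h := (convex_uIcc 0 t).norm_image_sub_le_of_norm_hasDerivWithin_le (𝕜 := ℝ)
    (fun s _ => (hd s).hasDerivWithinAt) hb Set.left_mem_uIcc Set.right_mem_uIcc
  simp only [boundedGroup_zero, zero_smul, sub_zero, one_apply_eq_self] at h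
  rw [sub_right_comm]
  exact h

/-- Bounded self-adjoint approximations of a self-adjoint operator. -/
theorem exists_yosida_approximation {H : 𝓗 →ₗ.[ℂ] 𝓗} (hH : IsSelfAdjoint H) :
    ∃ K : ℕ → 𝓗 →L[ℂ] 𝓗, (∀ n, IsSelfAdjoint (K n)) ∧ (∀ n m, Commute (K n) (K m)) ∧
      ∀ ψ χ, (ψ, χ) ∈ H.graph → Tendsto (fun n => K n ψ) atTop (𝓝 χ) := by
  choose R hR1 hR2 hR3 using fun c : {c : ℝ // c ≠ 0} => exists_resolvent hH c.2
  -- The resolvent identity; exchanging `c` and `d` in it shows that resolvents commute.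
  have hres : ∀ c d φ, R c φ - R d φ = (Complex.I * (c.1 - d.1)) • R d (R c φ) := by
    intro c d φ
    have := hR2 d _ _ (hR1 c φ)
    rw [map_sub, map_add, map_smul, map_smul] at this
    linear_combination (norm := module) (-1 : ℂ) • this
  have hcomm : ∀ c d, Commute (R c) (R d) := by
    intro c d
    by_cases hcd : c = d
    · rw [hcd]
    · ext φ
      have h1 := hres c d φ
      have h2 := hres d c φ
      have h3 : (Complex.I * (c.1 - d.1) : ℂ) ≠ 0 := by
        refine mul_ne_zero Complex.I_ne_zero (sub_ne_zero.2 fun h => hcd (Subtype.ext ?_))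
        exact_mod_cast h
      have h4 : (Complex.I * (c.1 - d.1)) • R d (R c φ) =
          (Complex.I * (c.1 - d.1)) • R c (R d φ) := by
        rw [← h1, ← neg_sub, h2, ← neg_smul]
        congr 1
        ring
      exact (smul_right_injective 𝓗 h3 h4).symm
  have hadj : ∀ c d φ η, d.1 = -c.1 → inner ℂ (R c φ) η = inner ℂ φ (R d η) := by
    intro c d φ η hdc
    have := inner_eq_of_mem_graph hH (hR1 c φ) (hR1 d η)
    rw [inner_add_left, inner_add_right, inner_smul_left, inner_smul_right, hdc] at this
    simp only [map_mul, Complex.conj_I, Complex.conj_ofReal, Complex.ofReal_neg] at this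
    linear_combination -this
  have hlim : ∀ (c : ℕ → {c : ℝ // c ≠ 0}), (∀ n, |(c n).1| = n + 1) → ∀ g,
      Tendsto (fun n => (-(Complex.I * (c n).1)) • R (c n) g) atTop (𝓝 g) := by
    intro c hc g
    have key : Tendsto (fun n => ((-(Complex.I * (c n).1)) • R (c n) - 1) g) atTop (𝓝 0) := by
      refine tendsto_clm_apply_of_dense (C := 2) (fun n => ?_) (dense_fst_graph hH) ?_ g
      · refine (norm_sub_le _ _).trans ?_
        have h1 : ‖(-(Complex.I * (c n).1)) • R (c n)‖ ≤ 1 := by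
          refine ContinuousLinearMap.opNorm_le_bound _ zero_le_one fun φ => ?_
          rw [smul_apply, norm_smul]
          simpa using hR3 (c n) φ
        have h2 : ‖(1 : 𝓗 →L[ℂ] 𝓗)‖ ≤ 1 := ContinuousLinearMap.norm_id_le
        linarith
      · rintro ψ ⟨χ, h⟩
        have h0 : Tendsto (fun n : ℕ => ‖χ‖ / (n + 1)) atTop (𝓝 0) := by
          have := (tendsto_one_div_add_atTop_nhds_zero_nat (𝕜 := ℝ)).const_mul ‖χ‖
          simpa [div_eq_mul_inv] using this
        refine squeeze_zero_norm (fun n => ?_) h0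
        have h1 := hR2 (c n) _ _ h
        rw [map_sub, map_smul, sub_eq_iff_eq_add, ← sub_eq_iff_eq_add'] at h1
        have h2 : ((-(Complex.I * (c n).1)) • R (c n) - 1) ψ = -R (c n) χ := by
          rw [sub_apply, smul_apply, neg_smul, ← h1, one_apply_eq_self]
          abel
        rw [h2, norm_neg, le_div_iff₀ (by positivity), mul_comm, ← hc n]
        exact hR3 _ _
    have := key.add_const g
    simpa using this
  let p : ℕ → {c : ℝ // c ≠ 0} := fun n => ⟨n + 1, by positivity⟩
  let q : ℕ → {c : ℝ // c ≠ 0} := fun n => ⟨-(n + 1), neg_ne_zero.2 (by positivity)⟩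
  have hp : ∀ n, |(p n).1| = n + 1 := fun n => abs_of_nonneg (by positivity)
  have hq : ∀ n, |(q n).1| = n + 1 := fun n => by
    change |-((n : ℝ) + 1)| = _
    rw [abs_neg]; exact hp n
  -- With `c = n + 1` this is `c² H (H² + c²)⁻¹`. It is self-adjoint because the resolvents at `ic`
  -- and `-ic` are adjoint to each other. On the domain it equals half the sum of `-ic R(ic)` and
  -- `ic R(-ic)` applied to `Hψ`, and both factors tend strongly to the identity.
  refine ⟨fun n => (((n : ℝ) + 1) ^ 2 / 2 : ℝ) • (R (p n) + R (q n)), fun n => ?_, fun n m => ?_,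
    fun ψ χ h => ?_⟩
  · refine IsSelfAdjoint.smul (IsSelfAdjoint.all _) ?_
    rw [ContinuousLinearMap.isSelfAdjoint_iff_isSymmetric]
    intro φ η
    change inner ℂ (R (p n) φ + R (q n) φ) η = inner ℂ φ (R (p n) η + R (q n) η)
    rw [inner_add_left, inner_add_right, hadj (p n) (q n) φ η rfl,
      hadj (q n) (p n) φ η (by simp [p, q]), add_comm]
  · refine Commute.smul_left (Commute.smul_right ?_ _) _
    exact ((hcomm _ _).add_right (hcomm _ _)).add_left ((hcomm _ _).add_right (hcomm _ _))
  · have h1 := ((hlim p hp χ).add (hlim q hq χ)).const_smul (1 / 2 : ℂ)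
    have h2 : (1 / 2 : ℂ) • (χ + χ) = χ := by rw [← two_smul ℂ χ, smul_smul]; norm_num
    rw [h2] at h1
    refine h1.congr fun n => ?_
    have e : ∀ c, R c χ = ψ + (Complex.I * c.1) • R c ψ := fun c => by
      have := hR2 c _ _ h
      rw [map_sub, map_smul, sub_eq_iff_eq_add] at this
      exact this
    have hpn : ((p n).1 : ℂ) = n + 1 := by simp [p]
    have hqn : ((q n).1 : ℂ) = -(n + 1) := by simp [q]
    rw [e (p n), e (q n), hpn, hqn]
    have h3 : ∀ x : 𝓗, (((n : ℝ) + 1) ^ 2 / 2 : ℝ) • x = (((n : ℂ) + 1) ^ 2 / 2) • x := fun x => by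
      rw [← Complex.coe_smul]; norm_num
    rw [smul_apply, h3, add_apply]
    simp only [smul_add, smul_smul]
    have hI : Complex.I * Complex.I = -1 := Complex.I_mul_I
    match_scalars
    · ring
    · linear_combination (-(1 / 2 : ℂ) * ((n : ℂ) + 1) ^ 2) * hI
    · linear_combination (-(1 / 2 : ℂ) * ((n : ℂ) + 1) ^ 2) * hI

/-- **Stone's theorem**: a self-adjoint operator generates a unitary group. -/
theorem exists_isUnitaryGroup {H : 𝓗 →ₗ.[ℂ] 𝓗} (hH : IsSelfAdjoint H) :
    ∃ W, IsUnitaryGroup H W := by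
  obtain ⟨K, hK, hKc, hKlim⟩ := exists_yosida_approximation hH
  let V : ℕ → ℝ → 𝓗 →L[ℂ] 𝓗 := fun n t => boundedGroup (K n) t
  have hVn : ∀ n t ψ, ‖V n t ψ‖ = ‖ψ‖ := fun n t ψ => norm_boundedGroup_apply (hK n) t ψ
  have hcau : ∀ t ψ, CauchySeq fun n => V n t ψ := by
    intro t ψ
    rw [Metric.cauchySeq_iff']
    intro ε hε
    obtain ⟨φ, ⟨χ, hφ⟩, hd⟩ := (dense_fst_graph hH).exists_dist_lt ψ (ε := ε / 4) (by positivity)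
    obtain ⟨N, hN⟩ := Metric.cauchySeq_iff'.1 (hKlim φ χ hφ).cauchySeq (ε / (2 * (|t| + 1)))
      (by positivity)
    refine ⟨N, fun n hn => ?_⟩
    have h1 := norm_boundedGroup_sub_boundedGroup_le (hK n) (hK N) (hKc n N) t φ
    have h2 := hN n hn
    rw [dist_eq_norm, lt_div_iff₀ (by positivity)] at h2
    rw [dist_eq_norm] at hd ⊢
    have e : V n t ψ - V N t ψ = V n t (ψ - φ) + (V n t φ - V N t φ) - V N t (ψ - φ) := by
      rw [map_sub, map_sub]; abel
    rw [e]
    refine (norm_sub_le _ _).trans_lt ?_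
    have h3 := norm_add_le (V n t (ψ - φ)) (V n t φ - V N t φ)
    rw [hVn] at h3 ⊢
    change ‖V n t φ - V N t φ‖ ≤ _ at h1
    nlinarith [norm_nonneg (K n φ - K N φ)]
  choose w hw using fun t ψ => cauchySeq_tendsto_of_complete (hcau t ψ)
  let W : ℝ → 𝓗 →L[ℂ] 𝓗 := fun t => continuousLinearMapOfTendsto (fun n => V n t)
    (f := w t) (tendsto_pi_nhds.2 (hw t))
  have hW : ∀ t ψ, Tendsto (fun n => V n t ψ) atTop (𝓝 (W t ψ)) := hw
  have hWn : ∀ t ψ, ‖W t ψ‖ = ‖ψ‖ := fun t ψ =>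
    tendsto_nhds_unique (hW t ψ).norm (by simp only [hVn]; exact tendsto_const_nhds)
  have hW0 : W 0 = 1 := by
    ext ψ
    refine tendsto_nhds_unique (hW 0 ψ) ?_
    simp only [V, boundedGroup_zero]
    exact tendsto_const_nhds
  have hWadd : ∀ s t, W (s + t) = W s * W t := by
    intro s t
    ext ψ
    refine tendsto_nhds_unique (hW (s + t) ψ) ?_
    have h1 : Tendsto (fun n => V n s (V n t ψ - W t ψ)) atTop (𝓝 0) := by
      refine squeeze_zero_norm (a := fun n => ‖V n t ψ - W t ψ‖) (fun n => (hVn _ _ _).le) ?_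
      simpa using ((hW t ψ).sub_const (W t ψ)).norm
    have h2 := h1.add (hW s (W t ψ))
    rw [zero_add] at h2
    refine h2.congr fun n => ?_
    rw [map_sub, sub_add_cancel]
    simp only [V, boundedGroup_add]
    rfl
  have hlin : ∀ ψ χ φ η, (ψ, χ) ∈ H.graph → (φ, η) ∈ H.graph → ∀ t,
      ‖W t ψ - ψ - t • (-Complex.I • χ)‖ ≤ (2 * ‖χ - φ‖ + |t| * ‖η‖) * |t| := by
    intro ψ χ φ η h h' t
    have h1 := hKlim ψ χ h
    have h2 := hKlim φ η h'
    refine le_of_tendsto_of_tendsto'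
      (((hW t ψ).sub_const ψ).sub ((h1.const_smul (-Complex.I)).const_smul t)).norm
      ((((h1.sub_const φ).norm.const_mul 2).add (h2.norm.const_mul |t|)).mul_const |t|)
      fun n => norm_boundedGroup_sub_linear_le (hK n) t ψ φ
  have hderiv : ∀ ψ χ, (ψ, χ) ∈ H.graph → HasDerivAt (fun t => W t ψ) (-Complex.I • χ) 0 := by
    intro ψ χ h
    rw [hasDerivAt_iff_isLittleO, Asymptotics.isLittleO_iff]
    intro c hc
    obtain ⟨φ, ⟨η, hφ⟩, hd⟩ := (dense_fst_graph hH).exists_dist_lt χ (ε := c / 4) (by positivity)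
    rw [dist_eq_norm] at hd
    have h3 : ∀ᶠ t : ℝ in 𝓝 0, |t| * ‖η‖ < c / 2 := by
      have : Tendsto (fun t : ℝ => |t| * ‖η‖) (𝓝 0) (𝓝 (|0| * ‖η‖)) :=
        (continuous_abs.mul continuous_const).tendsto 0
      rw [abs_zero, zero_mul] at this
      exact this.eventually (gt_mem_nhds (by positivity))
    filter_upwards [h3] with t ht
    rw [hW0, sub_zero, one_apply_eq_self, Real.norm_eq_abs]
    refine (hlin ψ χ φ η h hφ t).trans ?_
    gcongr
    linarith
  have hcont : ∀ ψ, Continuous fun t => W t ψ := by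
    refine continuous_apply_of_dense (C := 1) (D := {ψ : 𝓗 | ∃ χ, (ψ, χ) ∈ H.graph})
      (fun t => norm_le_one_of_norm_map (hWn t))
      ((dense_fst_graph hH).mono Submodule.subset_span) ?_
    rintro ψ ⟨χ, h⟩
    rw [continuous_iff_continuousAt]
    intro t
    have h1 : ContinuousAt (fun s => W t (W (s - t) ψ)) t := by
      refine (W t).continuous.continuousAt.comp ?_
      have h0 : ContinuousAt (fun s => W s ψ) (t - t) := by
        rw [sub_self]
        exact (hderiv ψ χ h).continuousAt
      exact h0.comp (f := fun s : ℝ => s - t) (by fun_prop)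
    refine h1.congr (Eventually.of_forall fun s => ?_)
    change (W t * W (s - t)) ψ = W s ψ
    rw [← hWadd]
    congr 2
    ring
  refine ⟨W, hW0, hWadd, hWn, hcont, fun ψ χ => ⟨hderiv ψ χ, fun h => ?_⟩⟩
  -- The generator has no proper extension of `H` to offer: differentiating the constant `⟨W t a, W
  -- t ψ⟩` at `0` gives exactly the weak test for `(ψ, χ)`.
  rw [mem_graph_iff_of_isSelfAdjoint hH]
  intro a b hab
  have hin : ∀ t, inner ℂ (W t a) (W t ψ) = inner ℂ a ψ := fun t => by
    let L : 𝓗 →ₗᵢ[ℂ] 𝓗 := ⟨(W t).toLinearMap, hWn t⟩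
    exact L.inner_map_map a ψ
  have h1 := (hderiv a b hab).inner ℂ h
  simp only [hin] at h1
  have h2 := (hasDerivAt_const (0 : ℝ) (inner ℂ a ψ)).unique h1
  simp only [hW0, one_apply_eq_self, inner_smul_left, inner_smul_right, map_neg,
    Complex.conj_I] at h2
  have h3 : Complex.I * (inner ℂ b ψ - inner ℂ a χ) = 0 := by linear_combination -h2
  exact sub_eq_zero.1 ((mul_eq_zero.1 h3).resolve_left Complex.I_ne_zero)

end Stone

/-! ### Operators acting on some of the particles -/

section Ampliation

variable {ν : ℕ} {ι κ κ' τ : Type}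

open Classical in
/-- The decomposition of an index set given by an embedding. -/
def sumOfEmbedding (i : ι ↪ τ) : ι ⊕ {k // k ∉ Set.range i} ≃ τ :=
  (Equiv.sumCongr (Equiv.ofInjective i i.injective) (Equiv.refl _)).trans
    (Equiv.sumCompl (· ∈ Set.range i))

theorem sumOfEmbedding_inl (i : ι ↪ τ) (a : ι) : sumOfEmbedding i (.inl a) = i a := rfl

theorem sumOfEmbedding_inr (i : ι ↪ τ) (b : {k // k ∉ Set.range i}) :
    sumOfEmbedding i (.inr b) = b := rfl

/-- Restriction of a configuration to the two parts of its index set. -/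
def splitSum (e : ι ⊕ κ ≃ τ) (x : τ → Space ν) : (ι → Space ν) × (κ → Space ν) :=
  (fun a => x (e (.inl a)), fun b => x (e (.inr b)))

/-- `splitSum` as a measurable equivalence. -/
def splitSumEquiv (e : ι ⊕ κ ≃ τ) : (τ → Space ν) ≃ᵐ (ι → Space ν) × (κ → Space ν) :=
  (MeasurableEquiv.piCongrLeft (fun _ : τ => Space ν) e).symm.trans
    (MeasurableEquiv.sumPiEquivProdPi fun _ => Space ν)

theorem coe_splitSumEquiv (e : ι ⊕ κ ≃ τ) : ⇑(splitSumEquiv (ν := ν) e) = splitSum e := rfl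

variable [Fintype ι] [Fintype κ] [Fintype κ'] [Fintype τ]

theorem measurePreserving_splitSum (e : ι ⊕ κ ≃ τ) :
    MeasurePreserving (splitSum (ν := ν) e) volume (volume.prod volume) :=
  (volume_measurePreserving_sumPiEquivProdPi (fun _ : ι ⊕ κ => Space ν)).comp
    (volume_measurePreserving_piCongrLeft (fun _ : τ => Space ν) e).symm

theorem measurePreserving_splitSumEquiv (e : ι ⊕ κ ≃ τ) :
    MeasurePreserving (splitSumEquiv (ν := ν) e) volume (volume.prod volume) :=
  measurePreserving_splitSum e

/-- The isometry `L²((ℝ^ν)^ι) ⊗ L²((ℝ^ν)^κ) → L²((ℝ^ν)^τ)` for a decomposition of `τ`. -/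
def embedSum (e : ι ⊕ κ ≃ τ) : (L2 ν ι ⊗[ℂ] L2 ν κ) →ₗᵢ[ℂ] L2 ν τ :=
  (Lp.compMeasurePreservingₗᵢ ℂ (splitSum e) (measurePreserving_splitSum e)).comp
    (tensorIso volume volume)

theorem denseRange_embedSum (e : ι ⊕ κ ≃ τ) : DenseRange (embedSum (ν := ν) e) := by
  suffices hs : Function.Surjective (Lp.compMeasurePreservingₗᵢ (E := ℂ) (p := 2) ℂ
      (splitSum (ν := ν) e) (measurePreserving_splitSum e)) from
    hs.denseRange.comp (denseRange_tensorIso volume volume) (LinearIsometry.continuous _)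
  intro h
  have hm := (measurePreserving_splitSumEquiv (ν := ν) e).symm
  refine ⟨Lp.compMeasurePreserving (splitSumEquiv e).symm hm h, Lp.ext ?_⟩
  refine (Lp.coeFn_compMeasurePreserving _ (measurePreserving_splitSum e)).trans ?_
  have h1 := (measurePreserving_splitSum e).quasiMeasurePreserving.ae
    (Lp.coeFn_compMeasurePreserving h hm)
  filter_upwards [h1] with x hx
  rw [Function.comp_apply, hx, Function.comp_apply, ← coe_splitSumEquiv,
    MeasurableEquiv.symm_apply_apply]

/-- The wave function `(x_ι, x_κ) ↦ f(x_ι) g(x_κ)`. -/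
def tens (e : ι ⊕ κ ≃ τ) : L2 ν ι →L[ℂ] L2 ν κ →L[ℂ] L2 ν τ :=
  LinearMap.mkContinuous₂ ((TensorProduct.mk ℂ _ _).compr₂ (embedSum e).toLinearMap) 1
    fun f g => by
      change ‖embedSum e (f ⊗ₜ g)‖ ≤ _
      rw [LinearIsometry.norm_map, TensorProduct.norm_tmul, one_mul]

theorem coeFn_tens (e : ι ⊕ κ ≃ τ) (f : L2 ν ι) (g : L2 ν κ) :
    tens e f g =ᵐ[volume] fun x => f (fun a => x (e (.inl a))) * g (fun b => x (e (.inr b))) :=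
  (Lp.coeFn_compMeasurePreserving (tensorFun volume volume f g)
    (measurePreserving_splitSum e)).trans
    ((measurePreserving_splitSum e).quasiMeasurePreserving.ae (coeFn_tensorFun volume volume f g))

/-- An almost everywhere property of the `ι`-coordinates. -/
theorem ae_comp_inl (e : ι ⊕ κ ≃ τ) {p : (ι → Space ν) → Prop} (h : ∀ᵐ y, p y) :
    ∀ᵐ x : τ → Space ν, p fun a => x (e (.inl a)) :=
  (Measure.quasiMeasurePreserving_fst.comp
    (measurePreserving_splitSum e).quasiMeasurePreserving).ae h

/-- An almost everywhere property of the `κ`-coordinates. -/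
theorem ae_comp_inr (e : ι ⊕ κ ≃ τ) {p : (κ → Space ν) → Prop} (h : ∀ᵐ y, p y) :
    ∀ᵐ x : τ → Space ν, p fun b => x (e (.inr b)) :=
  (Measure.quasiMeasurePreserving_snd.comp
    (measurePreserving_splitSum e).quasiMeasurePreserving).ae h

theorem clm_ext_tens {M : Type*} [NormedAddCommGroup M] [NormedSpace ℂ M] (e : ι ⊕ κ ≃ τ)
    {S T : L2 ν τ →L[ℂ] M} (h : ∀ f g, S (tens e f g) = T (tens e f g)) : S = T := by
  refine DFunLike.coe_injective ?_
  refine (denseRange_embedSum e).equalizer S.continuous T.continuous (funext fun t => ?_)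
  induction t with
  | zero => simp
  | add x y hx hy =>
    simp only [Function.comp_apply, map_add] at hx hy ⊢
    rw [hx, hy]
  | tmul f g => exact h f g

theorem clm_congr_tens {M : Type*} [NormedAddCommGroup M] [NormedSpace ℂ M] {e : ι ⊕ κ ≃ τ}
    {S T : L2 ν τ →L[ℂ] M} {f f' : L2 ν ι} {α β : Type} [Fintype α] [Fintype β] (e' : α ⊕ β ≃ κ)
    (h : ∀ g k, S (tens e f (tens e' g k)) = T (tens e f' (tens e' g k))) (G : L2 ν κ) :
    S (tens e f G) = T (tens e f' G) := by
  have : S ∘L tens e f = T ∘L tens e f' := clm_ext_tens e' h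
  exact DFunLike.congr_fun this G

/-- The operator acting as `A` on the `ι`-particles and as the identity on the `κ`-particles. -/
def amp (e : ι ⊕ κ ≃ τ) (A : L2 ν ι →L[ℂ] L2 ν ι) : L2 ν τ →L[ℂ] L2 ν τ :=
  ((embedSum e).toContinuousLinearMap ∘L A.rTensor (L2 ν κ)).extend
    (embedSum e).toContinuousLinearMap

theorem amp_embedSum (e : ι ⊕ κ ≃ τ) (A : L2 ν ι →L[ℂ] L2 ν ι) (z : L2 ν ι ⊗[ℂ] L2 ν κ) :
    amp e A (embedSum e z) = embedSum e (A.rTensor (L2 ν κ) z) :=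
  ContinuousLinearMap.extend_eq
    ((embedSum e).toContinuousLinearMap ∘L A.rTensor (L2 ν κ))
    (e := (embedSum e).toContinuousLinearMap)
    (denseRange_embedSum e) (embedSum e).isometry.isUniformInducing z

theorem amp_tens (e : ι ⊕ κ ≃ τ) (A : L2 ν ι →L[ℂ] L2 ν ι) (f : L2 ν ι) (g : L2 ν κ) :
    amp e A (tens e f g) = tens e (A f) g :=
  amp_embedSum e A (f ⊗ₜ g)

theorem norm_amp_le (e : ι ⊕ κ ≃ τ) (A : L2 ν ι →L[ℂ] L2 ν ι) : ‖amp e A‖ ≤ ‖A‖ := by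
  refine ContinuousLinearMap.opNorm_le_bound _ (norm_nonneg _) fun ψ => ?_
  refine (denseRange_embedSum e).induction_on ψ
    (isClosed_le (amp e A).continuous.norm (continuous_const.mul continuous_norm)) fun z => ?_
  rw [amp_embedSum, LinearIsometry.norm_map, LinearIsometry.norm_map]
  exact (A.rTensor (L2 ν κ)).le_of_opNorm_le (ContinuousLinearMap.norm_rTensor_le _ A) z

theorem onParticles_tens {m N : ℕ} (i : Fin m ↪o Fin N) (A : L2 ν (Fin m) →L[ℂ] L2 ν (Fin m))
    (f : L2 ν (Fin m)) (g : L2 ν {k // k ∉ Set.range i}) :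
    onParticles i A (tens (sumOfEmbedding i.toEmbedding) f g) =
      tens (sumOfEmbedding i.toEmbedding) (A f) g :=
  onParticles_embedAt_tmul i A f g

attribute [irreducible] tens amp

/-- Relabelling of particles. -/
theorem exists_relabel (σ : κ ≃ κ') (g : L2 ν κ) :
    ∃ g' : L2 ν κ', g' =ᵐ[volume] fun y => g fun b => y (σ b) := by
  have hm := (volume_measurePreserving_piCongrLeft (fun _ : κ' => Space ν) σ).symm
  exact ⟨Lp.compMeasurePreserving _ hm g, Lp.coeFn_compMeasurePreserving g hm⟩

/-- `amp e` depends only on the embedding of the `ι`-particles. -/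
theorem amp_tens_of_inl_eq (e : ι ⊕ κ ≃ τ) (e' : ι ⊕ κ' ≃ τ)
    (h : ∀ a, e (.inl a) = e' (.inl a)) (A : L2 ν ι →L[ℂ] L2 ν ι) (f : L2 ν ι) (g : L2 ν κ) :
    amp e' A (tens e f g) = tens e (A f) g := by
  have hr : ∀ b : κ, ∃ b' : κ', e' (.inr b') = e (.inr b) := by
    intro b
    rcases hb : e'.symm (e (.inr b)) with a | b'
    · rw [Equiv.symm_apply_eq, ← h] at hb
      simpa using e.injective hb
    · exact ⟨b', by rw [← hb, Equiv.apply_symm_apply]⟩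
  have hr' : ∀ b' : κ', ∃ b : κ, e (.inr b) = e' (.inr b') := by
    intro b
    rcases hb : e.symm (e' (.inr b)) with a | b'
    · rw [Equiv.symm_apply_eq, h] at hb
      simpa using e'.injective hb
    · exact ⟨b', by rw [← hb, Equiv.apply_symm_apply]⟩
  choose s hs using hr
  choose s' hs' using hr'
  -- Both complements label the same remaining particles. Relabelling along this bijection turns a
  -- product for `e` into one for `e'` with the same first factor.
  let σ : κ ≃ κ' := ⟨s, s', fun b => by
      have : e (.inr (s' (s b))) = e (.inr b) := by rw [hs', hs]
      simpa using e.injective this, fun b => by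
      have : e' (.inr (s (s' b))) = e' (.inr b) := by rw [hs, hs']
      simpa using e'.injective this⟩
  obtain ⟨g', hg'⟩ := exists_relabel σ g
  have key : ∀ f : L2 ν ι, tens e f g = tens e' f g' := by
    intro f
    refine Lp.ext ?_
    filter_upwards [coeFn_tens e f g, coeFn_tens e' f g', ae_comp_inr e' hg'] with x h1 h2 h3
    rw [h1, h2, h3]
    simp only [h]
    congr 2
    funext b
    exact congrArg x (hs b).symm
  rw [key, amp_tens, key]

theorem amp_eq_amp (e : ι ⊕ κ ≃ τ) (e' : ι ⊕ κ' ≃ τ)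
    (h : ∀ a, e (.inl a) = e' (.inl a)) (A : L2 ν ι →L[ℂ] L2 ν ι) : amp e A = amp e' A :=
  clm_ext_tens e fun f g => by rw [amp_tens, amp_tens_of_inl_eq e e' h]

end Ampliation

/-! ### Commutation of operators on disjoint sets of particles -/

section Decomposition

variable {ι ι' τ : Type}

variable [Fintype ι] [Fintype ι'] [Fintype τ]

/-- On threefold products `f f' g`, grouped in either of two ways, `A` changes only `f` and `B` only
`f'`. Such products determine a bounded operator. -/
theorem commute_amp_of_sum {ν : ℕ} {ρ : Type} [Fintype ρ] (E : ι ⊕ (ι' ⊕ ρ) ≃ τ)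
    (E' : ι' ⊕ (ι ⊕ ρ) ≃ τ) (h1 : ∀ a, E (.inl a) = E' (.inr (.inl a)))
    (h2 : ∀ b, E (.inr (.inl b)) = E' (.inl b))
    (h3 : ∀ c, E (.inr (.inr c)) = E' (.inr (.inr c))) (A : L2 ν ι →L[ℂ] L2 ν ι)
    (B : L2 ν ι' →L[ℂ] L2 ν ι') : Commute (amp E A) (amp E' B) := by
  have key : ∀ (f : L2 ν ι) (f' : L2 ν ι') (g : L2 ν ρ),
      tens E f (tens (Equiv.refl _) f' g) = tens E' f' (tens (Equiv.refl _) f g) := by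
    intro f f' g
    refine Lp.ext ?_
    filter_upwards [coeFn_tens E f (tens (Equiv.refl _) f' g),
      coeFn_tens E' f' (tens (Equiv.refl _) f g),
      ae_comp_inr E (coeFn_tens (Equiv.refl _) f' g),
      ae_comp_inr E' (coeFn_tens (Equiv.refl _) f g)] with x e1 e2 e3 e4
    rw [e1, e2, e3, e4]
    simp only [Equiv.refl_apply, h1, h2, h3]
    exact mul_left_comm _ _ _
  refine clm_ext_tens E fun f G => ?_
  refine clm_congr_tens (Equiv.refl _) (fun f' g => ?_) G
  have e1 := amp_tens E' B f' (tens (Equiv.refl _) f g)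
  have e2 := amp_tens E A f (tens (Equiv.refl _) (B f') g)
  have e3 := amp_tens E' B f' (tens (Equiv.refl _) (A f) g)
  have e4 := amp_tens E A f (tens (Equiv.refl _) f' g)
  have e5 : amp E A (amp E' B (tens E f (tens (Equiv.refl _) f' g))) =
      tens E (A f) (tens (Equiv.refl _) (B f') g) :=
    (congrArg (fun z => amp E A z) ((congrArg (fun z => amp E' B z) (key f f' g)).trans
      (e1.trans (key f (B f') g).symm))).trans e2
  have e6 : amp E' B (amp E A (tens E f (tens (Equiv.refl _) f' g))) =
      tens E' (B f') (tens (Equiv.refl _) (A f) g) :=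
    (congrArg (fun z => amp E' B z) (e4.trans (key (A f) f' g))).trans e3
  exact e5.trans ((key (A f) (B f') g).trans e6.symm)

open Classical in
/-- Operators on disjoint sets of particles commute. -/
theorem commute_amp_of_disjoint {ν : ℕ} {κ κ' : Type} [Fintype κ] [Fintype κ'] (e : ι ⊕ κ ≃ τ)
    (e' : ι' ⊕ κ' ≃ τ) (h : ∀ a b, e (.inl a) ≠ e' (.inl b)) (A : L2 ν ι →L[ℂ] L2 ν ι)
    (B : L2 ν ι' →L[ℂ] L2 ν ι') : Commute (amp e A) (amp e' B) := by
  -- Disjointness lets both decompositions be replaced by a common one into `ι`, `ι'` and the rest.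
  let p : ι ⊕ ι' ↪ τ := ⟨Sum.elim (fun a => e (.inl a)) (fun b => e' (.inl b)), by
    rintro (a | a) (b | b) hab
    · simpa using hab
    · exact absurd hab (h a b)
    · exact absurd hab.symm (h b a)
    · simpa using hab⟩
  let E := sumOfEmbedding p
  let E1 : ι ⊕ (ι' ⊕ {k // k ∉ Set.range p}) ≃ τ := (Equiv.sumAssoc _ _ _).symm.trans E
  let E2 : ι' ⊕ (ι ⊕ {k // k ∉ Set.range p}) ≃ τ := (Equiv.sumAssoc _ _ _).symm.trans
    ((Equiv.sumCongr (Equiv.sumComm _ _) (Equiv.refl _)).trans E)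
  rw [amp_eq_amp e E1 (fun _ => rfl), amp_eq_amp e' E2 (fun _ => rfl)]
  exact commute_amp_of_sum E1 E2 (fun _ => rfl) (fun _ => rfl) (fun _ => rfl) A B

theorem onParticles_eq_amp {ν m N : ℕ} (i : Fin m ↪o Fin N) (A : L2 ν (Fin m) →L[ℂ] L2 ν (Fin m)) :
    onParticles i A = amp (sumOfEmbedding i.toEmbedding) A := by
  refine clm_ext_tens (sumOfEmbedding i.toEmbedding) fun f g => ?_
  rw [amp_tens]
  exact onParticles_tens i A f g

end Decomposition

/-! ### Product wave functions and their totality -/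

section ProductStates

variable {ν : ℕ} {ι κ τ : Type} [Fintype ι] [Fintype κ] [Fintype τ]

theorem measurePreserving_const_fin_one :
    MeasurePreserving (fun (y : Space ν) (_ : Fin 1) => y) volume volume :=
  (volume_preserving_funUnique (Fin 1) (Space ν)).symm

theorem memLp_single (f : L2 ν (Fin 1)) : MemLp (fun y : Space ν => f fun _ => y) 2 volume :=
  (Lp.memLp f).comp_measurePreserving measurePreserving_const_fin_one

theorem aestronglyMeasurable_eval_single (f : L2 ν (Fin 1)) (k : ι) :
    AEStronglyMeasurable (fun x : ι → Space ν => f fun _ => x k) volume :=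
  (memLp_single f).1.comp_quasiMeasurePreserving
    (Measure.quasiMeasurePreserving_eval (fun _ : ι => (volume : Measure (Space ν))) k)

theorem aestronglyMeasurable_prod_single (f : ι → L2 ν (Fin 1)) :
    AEStronglyMeasurable (fun x : ι → Space ν => ∏ k, f k fun _ => x k) volume :=
  Finset.aestronglyMeasurable_fun_prod _ fun k _ => aestronglyMeasurable_eval_single (f k) k

theorem integral_norm_sq_single (f : L2 ν (Fin 1)) :
    ∫ y : Space ν, ‖f fun _ => y‖ ^ 2 = ‖f‖ ^ 2 := by
  have h1 := L2.inner_def (𝕜 := ℂ) f f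
  rw [inner_self_eq_norm_sq_to_K] at h1
  have h2 : ∫ x, ‖f x‖ ^ 2 = ‖f‖ ^ 2 := by
    have h3 : ∀ x, inner ℂ (f x) (f x) = ((‖f x‖ ^ 2 : ℝ) : ℂ) := fun x => by
      rw [inner_self_eq_norm_sq_to_K]
      push_cast
      rfl
    simp only [h3, integral_complex_ofReal] at h1
    have h4 : ((‖f‖ ^ 2 : ℝ) : ℂ) = ((∫ x, ‖f x‖ ^ 2 : ℝ) : ℂ) := by
      rw [← h1]; push_cast; rfl
    exact_mod_cast h4.symm
  rw [← h2]
  exact (measurePreserving_const_fin_one (ν := ν)).integral_comp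
    (MeasurableEquiv.funUnique (Fin 1) (Space ν)).symm.measurableEmbedding
    fun x => ‖f x‖ ^ 2

theorem memLp_prod_single (f : ι → L2 ν (Fin 1)) :
    MemLp (fun x : ι → Space ν => ∏ k, f k fun _ => x k) 2 volume := by
  rw [memLp_two_iff_integrable_sq_norm (aestronglyMeasurable_prod_single f)]
  simp only [norm_prod, ← Finset.prod_pow]
  exact Integrable.fintype_prod (f := fun k y => ‖f k fun _ => y‖ ^ 2) fun k =>
    (memLp_two_iff_integrable_sq_norm (memLp_single (f k)).1).1 (memLp_single (f k))

/-- The product wave function `x ↦ ∏ₖ fₖ(xₖ)`. -/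
def prodState (f : ι → L2 ν (Fin 1)) : L2 ν ι := (memLp_prod_single f).toLp _

theorem coeFn_prodState (f : ι → L2 ν (Fin 1)) :
    prodState f =ᵐ[volume] fun x => ∏ k, f k fun _ => x k := MemLp.coeFn_toLp _

theorem ae_eval_single (k : ι) {p : (Fin 1 → Space ν) → Prop} (h : ∀ᵐ y, p y) :
    ∀ᵐ x : ι → Space ν, p fun _ => x k :=
  (measurePreserving_const_fin_one.quasiMeasurePreserving.comp
    (Measure.quasiMeasurePreserving_eval (fun _ : ι => (volume : Measure (Space ν))) k)).ae h

theorem norm_prodState (f : ι → L2 ν (Fin 1)) : ‖prodState f‖ = ∏ k, ‖f k‖ := by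
  have h1 : ‖prodState f‖ ^ 2 = (∏ k, ‖f k‖) ^ 2 := by
    have h2 := L2.inner_def (𝕜 := ℂ) (prodState f) (prodState f)
    have h3 : ∫ x, inner ℂ (prodState f x) (prodState f x) =
        ((∫ x : ι → Space ν, ∏ k, ‖f k fun _ => x k‖ ^ 2 : ℝ) : ℂ) := by
      rw [← integral_complex_ofReal]
      refine integral_congr_ae ?_
      filter_upwards [coeFn_prodState f] with x hx
      rw [hx, inner_self_eq_norm_sq_to_K, norm_prod, Finset.prod_pow]
      push_cast
      rfl
    rw [h3, inner_self_eq_norm_sq_to_K,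
      integral_fintype_prod_volume_eq_prod (fun k (y : Space ν) => ‖f k fun _ => y‖ ^ 2)] at h2
    simp only [integral_norm_sq_single] at h2
    have h4 : ((‖prodState f‖ ^ 2 : ℝ) : ℂ) = (((∏ k, ‖f k‖) ^ 2 : ℝ) : ℂ) := by
      rw [← Finset.prod_pow, ← h2]; push_cast; rfl
    exact_mod_cast h4
  exact (pow_left_inj₀ (norm_nonneg _) (Finset.prod_nonneg fun _ _ => norm_nonneg _)
    two_ne_zero).1 h1

/-- Product wave functions as a continuous multilinear map of their factors. -/
def prodStateMultilinear : ContinuousMultilinearMap ℂ (fun _ : ι => L2 ν (Fin 1)) (L2 ν ι) :=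
  MultilinearMap.mkContinuous
    { toFun := prodState
      map_update_add' := fun {_} f k a b => by
        refine Lp.ext ?_
        filter_upwards [coeFn_prodState (Function.update f k (a + b)),
          coeFn_prodState (Function.update f k a), coeFn_prodState (Function.update f k b),
          Lp.coeFn_add (prodState (Function.update f k a)) (prodState (Function.update f k b)),
          ae_eval_single k (Lp.coeFn_add a b)] with x h1 h2 h3 h4 h5
        rw [h4, Pi.add_apply]
        rw [h1, h2, h3]
        have key : ∀ c : L2 ν (Fin 1), ∏ l, (Function.update f k c l) (fun _ => x l) =
            c (fun _ => x k) * ∏ l ∈ Finset.univ.erase k, f l (fun _ => x l) := fun c => by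
          rw [← Finset.mul_prod_erase _ _ (Finset.mem_univ k), Function.update_self]
          congr 1
          refine Finset.prod_congr rfl fun l hl => ?_
          rw [Function.update_of_ne (Finset.ne_of_mem_erase hl)]
        rw [key, key, key, h5, Pi.add_apply, add_mul]
      map_update_smul' := fun {_} f k c a => by
        refine Lp.ext ?_
        filter_upwards [coeFn_prodState (Function.update f k (c • a)),
          coeFn_prodState (Function.update f k a),
          Lp.coeFn_smul c (prodState (Function.update f k a)),
          ae_eval_single k (Lp.coeFn_smul c a)] with x h1 h2 h4 h5
        rw [h4, Pi.smul_apply]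
        rw [h1, h2]
        have key : ∀ c : L2 ν (Fin 1), ∏ l, (Function.update f k c l) (fun _ => x l) =
            c (fun _ => x k) * ∏ l ∈ Finset.univ.erase k, f l (fun _ => x l) := fun c => by
          rw [← Finset.mul_prod_erase _ _ (Finset.mem_univ k), Function.update_self]
          congr 1
          refine Finset.prod_congr rfl fun l hl => ?_
          rw [Function.update_of_ne (Finset.ne_of_mem_erase hl)]
        rw [key, key, h5, Pi.smul_apply, smul_mul_assoc] }
    1 fun f => by rw [one_mul]; exact (norm_prodState f).le

theorem prodStateMultilinear_apply (f : ι → L2 ν (Fin 1)) :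
    prodStateMultilinear f = prodState f := rfl

theorem continuous_prodState : Continuous (prodState (ν := ν) (ι := ι)) :=
  prodStateMultilinear.cont

theorem tens_prodState (e : ι ⊕ κ ≃ τ) (f : τ → L2 ν (Fin 1)) :
    tens e (prodState fun a => f (e (.inl a))) (prodState fun b => f (e (.inr b))) =
      prodState f := by
  refine Lp.ext ?_
  filter_upwards [coeFn_tens e (prodState fun a => f (e (.inl a)))
    (prodState fun b => f (e (.inr b))), coeFn_prodState f,
    ae_comp_inl e (coeFn_prodState fun a => f (e (.inl a))),
    ae_comp_inr e (coeFn_prodState fun b => f (e (.inr b)))] with x h1 h2 h3 h4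
  rw [h1, h2, h3, h4, ← e.prod_comp, Fintype.prod_sum_type]

theorem prodState_fin_one (f : L2 ν (Fin 1)) : prodState (fun _ : Fin 1 => f) = f := by
  refine Lp.ext ?_
  filter_upwards [coeFn_prodState fun _ : Fin 1 => f] with x h1
  rw [h1, Fin.prod_univ_one]
  congr 1
  funext k
  rw [Subsingleton.elim k 0]

/-- The embedding of one particle. -/
def single (k : ι) : Fin 1 ↪ ι := ⟨fun _ => k, fun _ _ _ => Subsingleton.elim _ _⟩

open Classical in
theorem card_compl_single_lt (k : ι) :
    Fintype.card {l // l ∉ Set.range (single k)} < Fintype.card ι :=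
  Fintype.card_subtype_lt (x := k) fun h => h ⟨0, rfl⟩

open Classical in
/-- Two bounded operators that agree on product states are equal. -/
theorem clm_ext_prodState {M : Type*} [NormedAddCommGroup M] [NormedSpace ℂ M]
    {S T : L2 ν ι →L[ℂ] M} (h : ∀ f, S (prodState f) = T (prodState f)) : S = T := by
  induction hn : Fintype.card ι using Nat.strong_induction_on generalizing ι with
  | _ n ih =>
    rcases isEmpty_or_nonempty ι with hι | ⟨⟨k⟩⟩
    · ext ψ
      -- Without particles the configuration space is a point, and `L²` is spanned by the empty
      -- product.
      have h1 : ψ = ψ (fun k => hι.elim k) • prodState (fun k => hι.elim k) := by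
        refine Lp.ext ?_
        filter_upwards [coeFn_prodState (ν := ν) fun k : ι => hι.elim k,
          Lp.coeFn_smul (ψ fun k => hι.elim k)
            (prodState (ν := ν) fun k : ι => hι.elim k)] with x h2 h3
        rw [h3, Pi.smul_apply, h2, Finset.univ_eq_empty, Finset.prod_empty, smul_eq_mul, mul_one]
        congr 1
        exact Subsingleton.elim _ _
      rw [h1, map_smul, map_smul, h]
    · let e := sumOfEmbedding (single k)
      refine clm_ext_tens e fun f g => ?_
      have h2 : S ∘L tens e f = T ∘L tens e f := by
        refine ih _ (hn ▸ card_compl_single_lt k) (fun f' => ?_) rfl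
        have h3 := tens_prodState e fun t => Sum.elim (fun _ => f) f' (e.symm t)
        simp only [Equiv.symm_apply_apply, Sum.elim_inl, Sum.elim_inr] at h3
        rw [prodState_fin_one] at h3
        rw [ContinuousLinearMap.comp_apply, ContinuousLinearMap.comp_apply, h3]
        exact h _
      exact DFunLike.congr_fun h2 g

/-- Product states with factors in a dense set are total. -/
theorem dense_span_prodState {D : Set (L2 ν (Fin 1))} (hD : Dense D) :
    Dense (Submodule.span ℂ {ψ : L2 ν ι | ∃ f, (∀ k, f k ∈ D) ∧ prodState f = ψ} :
      Set (L2 ν ι)) := by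
  rw [Submodule.dense_iff_topologicalClosure_eq_top, Submodule.topologicalClosure_eq_top_iff,
    Submodule.eq_bot_iff]
  intro h hh
  have h1 : innerSL ℂ h = 0 := by
    refine clm_ext_prodState fun f => ?_
    have hd : Dense {f : ι → L2 ν (Fin 1) | ∀ k, f k ∈ D} := by
      have := dense_pi (Set.univ : Set ι) (s := fun _ => D) fun _ _ => hD
      simpa [Set.pi] using this
    have h2 := hd.closure_eq ▸ Set.mem_univ f
    -- Products depend continuously on their factors, so orthogonality passes from factors in `D` to
    -- all factors.
    refine closure_minimal (s := {f : ι → L2 ν (Fin 1) | ∀ k, f k ∈ D})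
      (t := {f | innerSL ℂ h (prodState f) = (0 : L2 ν ι →L[ℂ] ℂ) (prodState f)}) ?_ ?_ h2
    · intro g hg
      have := Submodule.mem_orthogonal' _ _ |>.1 hh (prodState g)
        (Submodule.subset_span ⟨g, hg, rfl⟩)
      simpa using this
    · exact isClosed_eq ((innerSL ℂ h).continuous.comp continuous_prodState)
        ((0 : L2 ν ι →L[ℂ] ℂ).continuous.comp continuous_prodState)
  have h2 := DFunLike.congr_fun h1 h
  simpa using h2

end ProductStates

/-! ### Tensor powers of one-particle operators -/

section TensorPower

variable {ν : ℕ} {ι κ τ : Type} [Fintype ι] [Fintype κ] [Fintype τ]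

open Classical in
theorem amp_single_prodState (k : ι) (u : L2 ν (Fin 1) →L[ℂ] L2 ν (Fin 1))
    (f : ι → L2 ν (Fin 1)) : amp (sumOfEmbedding (single k)) u (prodState f) =
      prodState (Function.update f k (u (f k))) := by
  have h1 := tens_prodState (sumOfEmbedding (single k)) f
  have h2 := tens_prodState (sumOfEmbedding (single k)) (Function.update f k (u (f k)))
  have h3 : ∀ b : {l // l ∉ Set.range (single k)}, b.1 ≠ k := fun b hb => b.2 ⟨0, hb.symm⟩
  simp only [sumOfEmbedding_inl, sumOfEmbedding_inr, Function.update_of_ne (h3 _)] at h1 h2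
  have h4 : ∀ a : Fin 1, single k a = k := fun _ => rfl
  simp only [h4, Function.update_self, prodState_fin_one] at h1 h2
  rw [← h1, amp_tens, h2]

-- Built by letting `u` act on one particle after another; each stage is an ampliation, of norm at
-- most `‖u‖`.
open Classical in
theorem exists_tensorPower (u : L2 ν (Fin 1) →L[ℂ] L2 ν (Fin 1)) :
    ∃ T : L2 ν ι →L[ℂ] L2 ν ι, (‖u‖ ≤ 1 → ‖T‖ ≤ 1) ∧
      ∀ f, T (prodState f) = prodState fun k => u (f k) := by
  suffices h : ∀ s : Finset ι, ∃ T : L2 ν ι →L[ℂ] L2 ν ι, (‖u‖ ≤ 1 → ‖T‖ ≤ 1) ∧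
      ∀ f, T (prodState f) = prodState fun k => if k ∈ s then u (f k) else f k by
    simpa using h Finset.univ
  intro s
  induction s using Finset.induction_on with
  | empty => exact ⟨1, fun _ => ContinuousLinearMap.norm_id_le, fun f => by simp⟩
  | insert k s hk ih =>
    obtain ⟨T, h1, h2⟩ := ih
    refine ⟨amp (sumOfEmbedding (single k)) u * T, fun hu => ?_, fun f => ?_⟩
    · exact (norm_mul_le _ _).trans
        (mul_le_one₀ ((norm_amp_le _ _).trans hu) (norm_nonneg _) (h1 hu))
    · rw [mul_apply_eq_comp, h2, amp_single_prodState]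
      congr 1
      funext l
      by_cases hl : l = k
      · subst hl
        simp [hk]
      · simp [hl]

/-- The tensor power `u ⊗ ⋯ ⊗ u` of a one-particle operator. -/
def tensorPower (ι : Type) [Fintype ι] (u : L2 ν (Fin 1) →L[ℂ] L2 ν (Fin 1)) :
    L2 ν ι →L[ℂ] L2 ν ι := (exists_tensorPower u).choose

theorem tensorPower_prodState (u : L2 ν (Fin 1) →L[ℂ] L2 ν (Fin 1)) (f : ι → L2 ν (Fin 1)) :
    tensorPower ι u (prodState f) = prodState fun k => u (f k) :=
  (exists_tensorPower u).choose_spec.2 f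

theorem norm_tensorPower_le {u : L2 ν (Fin 1) →L[ℂ] L2 ν (Fin 1)} (hu : ‖u‖ ≤ 1) :
    ‖tensorPower ι u‖ ≤ 1 :=
  (exists_tensorPower u).choose_spec.1 hu

theorem tensorPower_one : tensorPower ι (1 : L2 ν (Fin 1) →L[ℂ] L2 ν (Fin 1)) = 1 :=
  clm_ext_prodState fun f => tensorPower_prodState _ f

theorem tensorPower_mul (u v : L2 ν (Fin 1) →L[ℂ] L2 ν (Fin 1)) :
    tensorPower ι (u * v) = tensorPower ι u * tensorPower ι v :=
  clm_ext_prodState fun f => by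
    rw [mul_apply_eq_comp, tensorPower_prodState, tensorPower_prodState, tensorPower_prodState]
    rfl

theorem tensorPower_tens (e : ι ⊕ κ ≃ τ) (u : L2 ν (Fin 1) →L[ℂ] L2 ν (Fin 1)) (F : L2 ν ι)
    (G : L2 ν κ) : tensorPower τ u (tens e F G) =
      tens e (tensorPower ι u F) (tensorPower κ u G) := by
  have h1 : ∀ (f : ι → L2 ν (Fin 1)) (g : κ → L2 ν (Fin 1)),
      tensorPower τ u (tens e (prodState f) (prodState g)) =
        tens e (tensorPower ι u (prodState f)) (tensorPower κ u (prodState g)) := by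
    intro f g
    have h3 := tens_prodState e fun t => Sum.elim f g (e.symm t)
    have h4 := tens_prodState e fun t => u (Sum.elim f g (e.symm t))
    simp only [Equiv.symm_apply_apply, Sum.elim_inl, Sum.elim_inr] at h3 h4
    rw [h3, tensorPower_prodState, tensorPower_prodState, tensorPower_prodState, h4]
  have h2 : ∀ f : ι → L2 ν (Fin 1), tensorPower τ u ∘L tens e (prodState f) =
      tens e (tensorPower ι u (prodState f)) ∘L tensorPower κ u := fun f =>
    clm_ext_prodState fun g => h1 f g
  have h3 : tensorPower τ u ∘L (tens e).flip G =
      (tens e).flip (tensorPower κ u G) ∘L tensorPower ι u :=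
    clm_ext_prodState fun f => DFunLike.congr_fun (h2 f) G
  exact DFunLike.congr_fun h3 F

/-- Conjugation by a tensor power preserves the localization of operators. -/
theorem tensorPower_mul_amp_mul (e : ι ⊕ κ ≃ τ) {u v : L2 ν (Fin 1) →L[ℂ] L2 ν (Fin 1)}
    (huv : u * v = 1) (A : L2 ν ι →L[ℂ] L2 ν ι) :
    tensorPower τ u * amp e A * tensorPower τ v =
      amp e (tensorPower ι u * A * tensorPower ι v) := by
  refine clm_ext_tens e fun F G => ?_
  have h1 := tensorPower_tens e v F G
  have h2 := amp_tens e A (tensorPower ι v F) (tensorPower κ v G)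
  have h3 := tensorPower_tens e u (A (tensorPower ι v F)) (tensorPower κ v G)
  -- On the particles not touched by `A`, the two tensor powers cancel.
  have h4 : tensorPower κ u (tensorPower κ v G) = G := by
    have := DFunLike.congr_fun (tensorPower_mul (ι := κ) u v) G
    rw [huv, tensorPower_one] at this
    exact this.symm
  have h5 := amp_tens e (tensorPower ι u * A * tensorPower ι v) F G
  rw [h4] at h3
  rw [h5]
  change tensorPower τ u (amp e A (tensorPower τ v (tens e F G))) = _
  rw [h1, h2, h3]
  rfl

end TensorPower

/-! ### The pair interaction as bounded multiplication operators -/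

section Multiplication

variable {ν : ℕ} {ι κ τ : Type} [Fintype ι] [Fintype κ] [Fintype τ]

theorem memLp_bounded_mul {w : (ι → Space ν) → ℝ} (hw : AEStronglyMeasurable w) {C : ℝ}
    (hC : ∀ x, |w x| ≤ C) (ψ : L2 ν ι) : MemLp (fun x => (w x : ℂ) * ψ x) 2 volume :=
  (Lp.memLp ψ).of_le_mul
    ((Complex.continuous_ofReal.comp_aestronglyMeasurable hw).mul (Lp.memLp ψ).1)
    (Filter.Eventually.of_forall fun x => by
      rw [norm_mul, Complex.norm_real, Real.norm_eq_abs]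
      exact mul_le_mul_of_nonneg_right (hC x) (norm_nonneg _))

theorem norm_toLp_bounded_mul_le {w : (ι → Space ν) → ℝ} (hw : AEStronglyMeasurable w) {C : ℝ}
    (hC : ∀ x, |w x| ≤ C) (ψ : L2 ν ι) : ‖(memLp_bounded_mul hw hC ψ).toLp _‖ ≤ C * ‖ψ‖ :=
  Lp.norm_le_mul_norm_of_ae_le_mul <| by
    filter_upwards [(memLp_bounded_mul hw hC ψ).coeFn_toLp] with x hx
    rw [hx, norm_mul, Complex.norm_real, Real.norm_eq_abs]
    exact mul_le_mul_of_nonneg_right (hC x) (norm_nonneg _)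

/-- Multiplication by a bounded real function. -/
def mulOp (w : (ι → Space ν) → ℝ) (hw : AEStronglyMeasurable w) (C : ℝ) (hC : ∀ x, |w x| ≤ C) :
    L2 ν ι →L[ℂ] L2 ν ι :=
  have hmem := memLp_bounded_mul hw hC
  LinearMap.mkContinuous
    { toFun := fun ψ => (memLp_bounded_mul hw hC ψ).toLp _
      map_add' := fun ψ φ => Lp.ext <| by
        filter_upwards [(hmem (ψ + φ)).coeFn_toLp, (hmem ψ).coeFn_toLp, (hmem φ).coeFn_toLp,
          Lp.coeFn_add ψ φ, Lp.coeFn_add ((hmem ψ).toLp _) ((hmem φ).toLp _)] with x h1 h2 h3 h4 h5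
        rw [h5, Pi.add_apply, h1, h2, h3, h4, Pi.add_apply, mul_add]
      map_smul' := fun c ψ => Lp.ext <| by
        filter_upwards [(hmem (c • ψ)).coeFn_toLp, (hmem ψ).coeFn_toLp,
          Lp.coeFn_smul c ψ, Lp.coeFn_smul c ((hmem ψ).toLp _)] with x h1 h2 h4 h5
        rw [RingHom.id_apply, h5, Pi.smul_apply, h1, h2, h4, Pi.smul_apply, smul_eq_mul,
          smul_eq_mul, mul_left_comm] }
    C (norm_toLp_bounded_mul_le hw hC)

theorem coeFn_mulOp (w : (ι → Space ν) → ℝ) (hw : AEStronglyMeasurable w) (C : ℝ)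
    (hC : ∀ x, |w x| ≤ C) (ψ : L2 ν ι) :
    mulOp w hw C hC ψ =ᵐ[volume] fun x => (w x : ℂ) * ψ x :=
  MemLp.coeFn_toLp (memLp_bounded_mul hw hC ψ)

theorem norm_mulOp_le (w : (ι → Space ν) → ℝ) (hw : AEStronglyMeasurable w) {C : ℝ}
    (hC0 : 0 ≤ C) (hC : ∀ x, |w x| ≤ C) : ‖mulOp w hw C hC‖ ≤ C :=
  ContinuousLinearMap.opNorm_le_bound _ hC0 (norm_toLp_bounded_mul_le hw hC)

theorem inner_mulOp (w : (ι → Space ν) → ℝ) (hw : AEStronglyMeasurable w) (C : ℝ)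
    (hC : ∀ x, |w x| ≤ C) (ψ φ : L2 ν ι) :
    inner ℂ (mulOp w hw C hC ψ) φ = inner ℂ ψ (mulOp w hw C hC φ) := by
  rw [L2.inner_def, L2.inner_def]
  refine integral_congr_ae ?_
  filter_upwards [coeFn_mulOp w hw C hC ψ, coeFn_mulOp w hw C hC φ] with x h1 h2
  simp only [h1, h2, RCLike.inner_apply, map_mul, Complex.conj_ofReal]
  ring

/-- An everywhere bounded representative of a bounded function. -/
def truncation (V : Lp ℝ ⊤ (volume : Measure (Space ν))) (y : Space ν) : ℝ :=
  max (-‖V‖) (min ‖V‖ (V y))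

theorem abs_truncation_le (V : Lp ℝ ⊤ (volume : Measure (Space ν))) (y : Space ν) :
    |truncation V y| ≤ ‖V‖ := by
  have h := norm_nonneg V
  exact abs_le.2 ⟨le_max_left _ _, max_le (by linarith) (min_le_left _ _)⟩

theorem truncation_ae_eq (V : Lp ℝ ⊤ (volume : Measure (Space ν))) :
    ∀ᵐ y, truncation V y = V y := by
  have h : ∀ᵐ y, ‖V y‖ ≤ ‖V‖ := by
    filter_upwards [ae_le_eLpNormEssSup (f := V) (μ := volume)] with y hy
    rw [← eLpNorm_exponent_top] at hy
    rw [Lp.norm_def]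
    rw [← ENNReal.ofReal_le_iff_le_toReal (Lp.eLpNorm_ne_top V), ofReal_norm]
    exact hy
  filter_upwards [h] with y hy
  have hy := abs_le.1 hy
  rw [truncation, min_eq_right hy.2, max_eq_right hy.1]

theorem measurable_truncation (V : Lp ℝ ⊤ (volume : Measure (Space ν))) :
    Measurable (truncation V) :=
  measurable_const.max (measurable_const.min (Lp.stronglyMeasurable V).measurable)

/-- The multiplication operator `V(x_k - x_l)`. -/
def pairOp (V : Lp ℝ ⊤ (volume : Measure (Space ν))) (k l : ι) : L2 ν ι →L[ℂ] L2 ν ι :=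
  mulOp (fun x => truncation V (x k - x l))
    ((measurable_truncation V).comp
      ((measurable_pi_apply k).sub (measurable_pi_apply l))).aestronglyMeasurable
    ‖V‖ fun _ => abs_truncation_le V _

theorem coeFn_pairOp (V : Lp ℝ ⊤ (volume : Measure (Space ν))) (k l : ι) (ψ : L2 ν ι) :
    pairOp V k l ψ =ᵐ[volume] fun x => (truncation V (x k - x l) : ℂ) * ψ x :=
  coeFn_mulOp _ _ _ _ ψ

theorem norm_pairOp_le (V : Lp ℝ ⊤ (volume : Measure (Space ν))) (k l : ι) :
    ‖pairOp V k l‖ ≤ ‖V‖ := norm_mulOp_le _ _ (norm_nonneg _) _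

theorem inner_pairOp (V : Lp ℝ ⊤ (volume : Measure (Space ν))) (k l : ι) (ψ φ : L2 ν ι) :
    inner ℂ (pairOp V k l ψ) φ = inner ℂ ψ (pairOp V k l φ) := inner_mulOp _ _ _ _ _ _

theorem pairOp_eq_amp (V : Lp ℝ ⊤ (volume : Measure (Space ν))) (e : ι ⊕ κ ≃ τ) (a b : ι) :
    pairOp V (e (.inl a)) (e (.inl b)) = amp e (pairOp V a b) := by
  refine clm_ext_tens e fun f g => ?_
  rw [amp_tens]
  refine Lp.ext ?_
  filter_upwards [coeFn_pairOp V (e (.inl a)) (e (.inl b)) (tens e f g), coeFn_tens e f g,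
    coeFn_tens e (pairOp V a b f) g, ae_comp_inl e (coeFn_pairOp V a b f)] with x h1 h2 h3 h4
  rw [h1, h2, h3, h4, mul_assoc]

/-- `V` is known only almost everywhere, so null sets must pull back to null sets under `x_k - x_l`.
This is what identifies the truncated interaction with the given one. -/
theorem quasiMeasurePreserving_sub_eval {k l : ι} (hkl : k ≠ l) :
    Measure.QuasiMeasurePreserving (fun x : ι → Space ν => x k - x l) volume volume := by
  classical
  let p : Fin 2 ↪ ι := ⟨![k, l], by
    intro a b hab
    fin_cases a <;> fin_cases b <;> simp_all [Ne.symm hkl]⟩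
  have h1 := (measurePreserving_splitSum (ν := ν) (sumOfEmbedding p)).quasiMeasurePreserving
  have h2 := (volume_preserving_finTwoArrow (Space ν)).quasiMeasurePreserving
  have h3 := quasiMeasurePreserving_sub (volume : Measure (Space ν)) volume
  exact h3.comp (h2.comp (Measure.quasiMeasurePreserving_fst.comp h1))

/-- The mean field interaction of the pairs of particles in `s`. -/
def pairSum {N : ℕ} (V : Lp ℝ ⊤ (volume : Measure (Space ν))) (s : Finset (Fin N × Fin N)) :
    L2 ν (Fin N) →L[ℂ] L2 ν (Fin N) := (1 / N : ℂ) • ∑ p ∈ s, pairOp V p.1 p.2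

/-- The pairs `i < j`. -/
def allPairs (N : ℕ) : Finset (Fin N × Fin N) := {p | p.1 < p.2}

theorem inner_pairSum {N : ℕ} (V : Lp ℝ ⊤ (volume : Measure (Space ν)))
    (s : Finset (Fin N × Fin N)) (ψ φ : L2 ν (Fin N)) :
    inner ℂ (pairSum V s ψ) φ = inner ℂ ψ (pairSum V s φ) := by
  simp only [pairSum, smul_apply, sum_apply, inner_smul_left, inner_smul_right, sum_inner,
    inner_sum, inner_pairOp]
  simp

theorem coeFn_pairSum_allPairs {N : ℕ} (V : Lp ℝ ⊤ (volume : Measure (Space ν)))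
    (ψ : L2 ν (Fin N)) : pairSum V (allPairs N) ψ =ᵐ[volume] fun x =>
      (((1 / N : ℝ) * ∑ i, ∑ j with i < j, V (x i - x j) : ℝ) : ℂ) * ψ x := by
  have h1 : ∀ᵐ x : Fin N → Space ν, ∀ p ∈ allPairs N,
      truncation V (x p.1 - x p.2) = V (x p.1 - x p.2) := by
    rw [Filter.eventually_all_finset]
    intro p hp
    exact (quasiMeasurePreserving_sub_eval (Finset.mem_filter.1 hp).2.ne).ae (truncation_ae_eq V)
  have h2 : ∀ᵐ x : Fin N → Space ν, ∀ p ∈ allPairs N,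
      pairOp V p.1 p.2 ψ x = (truncation V (x p.1 - x p.2) : ℂ) * ψ x := by
    rw [Filter.eventually_all_finset]
    exact fun p _ => coeFn_pairOp V p.1 p.2 ψ
  have h3 : pairSum V (allPairs N) ψ = (1 / N : ℂ) • ∑ p ∈ allPairs N, pairOp V p.1 p.2 ψ := by
    simp [pairSum, sum_apply]
  rw [h3]
  filter_upwards [h1, h2, Lp.coeFn_smul (1 / N : ℂ) (∑ p ∈ allPairs N, pairOp V p.1 p.2 ψ),
    Lp.coeFn_finsetSum (allPairs N) fun p => pairOp V p.1 p.2 ψ] with x e1 e2 e3 e4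
  rw [e3, Pi.smul_apply, e4, Finset.sum_apply, Finset.sum_congr rfl e2,
    Finset.sum_congr rfl fun p hp => by rw [e1 p hp]]
  have h5 : ∑ i, ∑ j with i < j, V (x i - x j) = ∑ p ∈ allPairs N, V (x p.1 - x p.2) := by
    rw [allPairs, Finset.sum_filter, ← Finset.univ_product_univ, Finset.sum_product]
    simp only [Finset.sum_filter]
  rw [h5, ← Finset.sum_mul, smul_eq_mul]
  push_cast
  ring

end Multiplication

/-! ### Fubini for a splitting of the particles -/

section Merge

variable {ν : ℕ} {ι κ τ : Type}

/-- The configuration with given restrictions to the two parts of the index set. -/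
def merge (e : ι ⊕ κ ≃ τ) (x : ι → Space ν) (y : κ → Space ν) : τ → Space ν :=
  fun t => Sum.elim x y (e.symm t)

theorem splitSumEquiv_symm_apply (e : ι ⊕ κ ≃ τ) (z : (ι → Space ν) × (κ → Space ν)) :
    (splitSumEquiv e).symm z = merge e z.1 z.2 := by
  rw [MeasurableEquiv.symm_apply_eq, coe_splitSumEquiv]
  simp [splitSum, merge]

variable [Fintype ι] [Fintype κ] [Fintype τ]

theorem locallyIntegrable_tens (e : ι ⊕ κ ≃ τ) {a : (ι → Space ν) → ℂ} {G : (κ → Space ν) → ℂ}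
    (ha : LocallyIntegrable a) (hG : LocallyIntegrable G) :
    LocallyIntegrable fun x : τ → Space ν =>
      a (fun k => x (e (.inl k))) * G (fun k => x (e (.inr k))) := by
  rw [locallyIntegrable_iff]
  intro K hK
  have hc1 : Continuous fun (x : τ → Space ν) k => x (e (.inl k)) := by fun_prop
  have hc2 : Continuous fun (x : τ → Space ν) k => x (e (.inr k)) := by fun_prop
  have h1 := ha.integrableOn_isCompact (hK.image hc1)
  have h2 := hG.integrableOn_isCompact (hK.image hc2)
  have h3 := Integrable.mul_prod h1 h2
  rw [Measure.prod_restrict] at h3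
  have h4 := ((measurePreserving_splitSumEquiv (ν := ν) e).integrableOn_comp_preimage
    (splitSumEquiv e).measurableEmbedding).2 h3
  refine h4.mono_set fun x hx => ?_
  exact ⟨⟨x, hx, rfl⟩, ⟨x, hx, rfl⟩⟩

theorem integrable_tens_mul (e : ι ⊕ κ ≃ τ) {a : (ι → Space ν) → ℂ} {G : (κ → Space ν) → ℂ}
    (ha : LocallyIntegrable a) (hG : LocallyIntegrable G) {θ : (τ → Space ν) → ℂ}
    (hθ : Continuous θ) (hθc : HasCompactSupport θ) :
    Integrable fun z : (ι → Space ν) × (κ → Space ν) =>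
      a z.1 * G z.2 * θ (merge e z.1 z.2) := by
  have h1 : Integrable fun x : τ → Space ν =>
      a (fun k => x (e (.inl k))) * G (fun k => x (e (.inr k))) * θ x := by
    simpa [mul_comm] using
      (locallyIntegrable_tens e ha hG).integrable_smul_left_of_hasCompactSupport hθ hθc
  have h2 := ((measurePreserving_splitSumEquiv (ν := ν) e).symm.integrable_comp_emb
    (splitSumEquiv e).symm.measurableEmbedding).2 h1
  refine h2.congr (Filter.Eventually.of_forall fun z => ?_)
  simp [splitSumEquiv_symm_apply, merge]

/-- Fubini with the `ι`-integral inside, so that a weak equation in the `ι`-variables can be used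
for each fixed `y`. -/
theorem integral_tens_mul (e : ι ⊕ κ ≃ τ) {a : (ι → Space ν) → ℂ} {G : (κ → Space ν) → ℂ}
    (ha : LocallyIntegrable a) (hG : LocallyIntegrable G) {θ : (τ → Space ν) → ℂ}
    (hθ : Continuous θ) (hθc : HasCompactSupport θ) :
    (Integrable fun y => G y * ∫ x, a x * θ (merge e x y)) ∧
    ∫ x : τ → Space ν, a (fun k => x (e (.inl k))) * G (fun k => x (e (.inr k))) * θ x =
      ∫ y, G y * ∫ x, a x * θ (merge e x y) := by
  have h1 := integrable_tens_mul e ha hG hθ hθc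
  have h2 : ∀ y, ∫ x, a x * G y * θ (merge e x y) = G y * ∫ x, a x * θ (merge e x y) := by
    intro y
    rw [← integral_const_mul]
    congr 1
    funext x
    ring
  constructor
  · simpa only [h2] using h1.integral_prod_right
  · rw [← (measurePreserving_splitSumEquiv (ν := ν) e).symm.integral_comp']
    simp only [splitSumEquiv_symm_apply]
    have h3 := integral_prod_symm _ h1
    simp only [h2] at h3
    rw [← h3, ← Measure.volume_eq_prod]
    congr 1
    funext z
    simp [merge]

end Merge

/-! ### Product states in the domain of the Hamiltonian -/

section ProductDomain

variable {ν N : ℕ} {κ : Type}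

theorem contDiff_merge {ι τ : Type} [Fintype ι] [Fintype τ] (e : ι ⊕ κ ≃ τ) (y : κ → Space ν) :
    ContDiff ℝ ∞ fun x : ι → Space ν => merge e x y := by
  rw [contDiff_pi]
  intro t
  rcases h : e.symm t with a | b
  · simpa [merge, h] using contDiff_apply ℝ (Space ν) a
  · simpa [merge, h] using contDiff_const

theorem IsTestFunction.comp_merge {m : ℕ} {f : (Fin N → Space ν) → ℂ} (hf : IsTestFunction f)
    (e : Fin m ⊕ κ ≃ Fin N) (y : κ → Space ν) : IsTestFunction fun x => f (merge e x y) := by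
  refine ⟨hf.1.comp (contDiff_merge e y), ?_⟩
  have hc : Continuous fun (x : Fin N → Space ν) k => x (e (.inl k)) := by fun_prop
  refine HasCompactSupport.intro (hf.2.isCompact.image hc) fun x hx => ?_
  by_contra h
  refine hx ⟨merge e x y, subset_tsupport _ h, ?_⟩
  funext k
  simp [merge]

theorem particleLaplacian_merge (f : (Fin N → Space ν) → ℂ) (e : Fin 1 ⊕ κ ≃ Fin N)
    (x : Fin 1 → Space ν) (y : κ → Space ν) :
    particleLaplacian 0 (fun x => f (merge e x y)) x =
      particleLaplacian (e (.inl 0)) f (merge e x y) := by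
  unfold particleLaplacian
  have h1 : merge e x y (e (.inl 0)) = x 0 := by simp [merge]
  have h2 : ∀ z, merge e (Function.update x 0 z) y =
      Function.update (merge e x y) (e (.inl 0)) z := by
    intro z
    funext t
    by_cases ht : t = e (.inl 0)
    · subst ht
      simp [merge]
    · rw [Function.update_of_ne ht]
      rcases h : e.symm t with a | b
      · rw [Equiv.symm_apply_eq, Subsingleton.elim a 0] at h
        exact absurd h ht
      · simp [merge, h]
  simp only [h1, h2]

theorem potential_one (U V : Space ν → ℝ) (x : Fin 1 → Space ν) : potential U V x = U (x 0) := by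
  have h : ∀ i j : Fin 1, ¬i < j := fun i j => by omega
  simp [potential, h]

variable [Fintype κ]

/-- The one-particle Hamiltonian acting on one factor of a tensor product. -/
theorem weakHamiltonian_tens {U V : Space ν → ℝ} (e : Fin 1 ⊕ κ ≃ Fin N) {F F' : L2 ν (Fin 1)}
    (hF : WeakHamiltonian U V F F') (G : L2 ν κ) :
    LocallyIntegrable (fun x => (U (x (e (.inl 0))) : ℂ) * tens e F G x) ∧
    ∀ f : (Fin N → Space ν) → ℂ, IsTestFunction f →
      ∫ x, tens e F' G x * f x =
        (∫ x, tens e F G x * (-particleLaplacian (e (.inl 0)) f x)) +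
          ∫ x, (U (x (e (.inl 0))) : ℂ) * tens e F G x * f x := by
  obtain ⟨h1, h2⟩ := hF
  simp only [potential_one] at h1 h2
  have hG : LocallyIntegrable fun y => G y := (Lp.memLp G).locallyIntegrable (by norm_num)
  have e1 := coeFn_tens e F G
  have e2 := coeFn_tens e F' G
  have hU := locallyIntegrable_tens e h1 hG
  have e3 : ∀ᵐ x : Fin N → Space ν, (U (x (e (.inl 0))) : ℂ) * tens e F G x =
      (fun x : Fin 1 → Space ν => (U (x 0) : ℂ) * F x) (fun k => x (e (.inl k))) *
        G (fun k => x (e (.inr k))) := by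
    filter_upwards [e1] with x hx
    rw [hx, mul_assoc]
  refine ⟨hU.congr (e3.mono fun x hx => hx.symm), fun f hf => ?_⟩
  have hL : Continuous fun x => -particleLaplacian (e (.inl 0)) f x :=
    (hf.continuous_particleLaplacian (e (.inl 0))).neg
  have hLc : HasCompactSupport fun x => -particleLaplacian (e (.inl 0)) f x :=
    (hf.hasCompactSupport_particleLaplacian (e (.inl 0))).comp_left (g := fun z => -z) neg_zero
  obtain ⟨-, i2⟩ := integral_tens_mul e (locallyIntegrable_L2 F') hG hf.1.continuous hf.2
  obtain ⟨j1, j2⟩ := integral_tens_mul e (locallyIntegrable_L2 F) hG hL hLc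
  obtain ⟨k1, k2⟩ := integral_tens_mul e h1 hG hf.1.continuous hf.2
  have c1 : ∫ x, tens e F' G x * f x =
      ∫ x, F' (fun k => x (e (.inl k))) * G (fun k => x (e (.inr k))) * f x :=
    integral_congr_ae (e2.mono fun x hx => by simp only [hx])
  have c2 : ∫ x, tens e F G x * (-particleLaplacian (e (.inl 0)) f x) =
      ∫ x, F (fun k => x (e (.inl k))) * G (fun k => x (e (.inr k))) *
        (-particleLaplacian (e (.inl 0)) f x) :=
    integral_congr_ae (e1.mono fun x hx => by simp only [hx])
  have c3 : ∫ x, (U (x (e (.inl 0))) : ℂ) * tens e F G x * f x =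
      ∫ x, (fun x : Fin 1 → Space ν => (U (x 0) : ℂ) * F x) (fun k => x (e (.inl k))) *
        G (fun k => x (e (.inr k))) * f x :=
    integral_congr_ae (e3.mono fun x hx => by simp only [hx])
  rw [c1, c2, c3, i2, j2]
  refine Eq.trans ?_ (congrArg _ k2.symm)
  -- For fixed `y` the slice of `f` is a one-particle test function; the weak equation for `F` is
  -- used on each slice and then integrated against `G`.
  rw [← integral_add j1 k1]
  congr 1
  funext y
  rw [← mul_add, h2 _ (hf.comp_merge e y)]
  simp only [Finset.univ_unique, Finset.sum_singleton, Fin.default_eq_zero,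
    particleLaplacian_merge]

open Classical in
/-- Product states of domain vectors of `H₁` are in the domain of `H_N`. -/
theorem prodState_mem_graph (U : Space ν → ℝ) (V : Lp ℝ ⊤ (volume : Measure (Space ν)))
    (f g : Fin N → L2 ν (Fin 1)) (h : ∀ k, (f k, g k) ∈ (hamiltonian U V 1).graph) :
    (prodState f, ∑ k, prodState (Function.update f k (g k)) +
      pairSum V (allPairs N) (prodState f)) ∈ (hamiltonian U V N).graph := by
  rw [mem_graph_hamiltonian]
  have hk : ∀ k : Fin N, LocallyIntegrable (fun x => (U (x k) : ℂ) * prodState f x) ∧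
      ∀ φ : (Fin N → Space ν) → ℂ, IsTestFunction φ →
        ∫ x, prodState (Function.update f k (g k)) x * φ x =
          (∫ x, prodState f x * (-particleLaplacian k φ x)) +
            ∫ x, (U (x k) : ℂ) * prodState f x * φ x := by
    intro k
    have h1 := tens_prodState (sumOfEmbedding (single k)) f
    have h2 := tens_prodState (sumOfEmbedding (single k)) (Function.update f k (g k))
    have h3 : ∀ b : {l // l ∉ Set.range (single k)}, b.1 ≠ k := fun b hb => b.2 ⟨0, hb.symm⟩
    simp only [sumOfEmbedding_inl, sumOfEmbedding_inr, Function.update_of_ne (h3 _)] at h1 h2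
    have h4 : ∀ a : Fin 1, single k a = k := fun _ => rfl
    simp only [h4, Function.update_self, prodState_fin_one] at h1 h2
    have h5 := weakHamiltonian_tens (sumOfEmbedding (single k))
      ((mem_graph_hamiltonian U V _ _).1 (h k)) (prodState fun b => f b.1)
    rw [h1, h2] at h5
    exact h5
  set Ψ := prodState f with hΨ
  set Q := pairSum V (allPairs N) Ψ with hQ
  -- The interaction part is bounded, so `Q` is itself in `L²`; the possibly singular part is a sum
  -- of one-particle terms, treated particle by particle.
  have hpot : ∀ᵐ x, (potential U V x : ℂ) * Ψ x = ∑ k, (U (x k) : ℂ) * Ψ x + Q x := by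
    filter_upwards [coeFn_pairSum_allPairs V Ψ] with x hx
    rw [hQ, hx, potential, Complex.ofReal_add, add_mul, Complex.ofReal_sum, Finset.sum_mul]
  have hloc : LocallyIntegrable fun x => ∑ k, (U (x k) : ℂ) * Ψ x :=
    locallyIntegrable_finsetSum _ fun k _ => (hk k).1
  refine ⟨(hloc.add (locallyIntegrable_L2 Q)).congr (hpot.mono fun x hx => hx.symm),
    fun φ hφ => ?_⟩
  have hc := hφ.1.continuous
  have i1 : ∀ k, Integrable fun x => prodState (Function.update f k (g k)) x * φ x := fun k =>
    integrable_mul_test (locallyIntegrable_L2 _) hc hφ.2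
  have i2 : Integrable fun x => Q x * φ x := integrable_mul_test (locallyIntegrable_L2 Q) hc hφ.2
  have i3 : ∀ k, Integrable fun x => (U (x k) : ℂ) * Ψ x * φ x := fun k =>
    integrable_mul_test (hk k).1 hc hφ.2
  have i4 : ∀ k, Integrable fun x => Ψ x * (-particleLaplacian k φ x) := fun k => by
    simpa using (integrable_mul_test (locallyIntegrable_L2 Ψ)
      (hφ.continuous_particleLaplacian k) (hφ.hasCompactSupport_particleLaplacian k)).neg
  have e1 : ∫ x, (∑ k, prodState (Function.update f k (g k)) + Q) x * φ x =
      ∑ k, (∫ x, prodState (Function.update f k (g k)) x * φ x) + ∫ x, Q x * φ x := by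
    rw [← integral_finsetSum _ fun k _ => i1 k, ← integral_add
      (integrable_finsetSum _ fun k _ => i1 k) i2]
    refine integral_congr_ae ?_
    filter_upwards [Lp.coeFn_add (∑ k, prodState (Function.update f k (g k))) Q,
      Lp.coeFn_finsetSum Finset.univ fun k => prodState (Function.update f k (g k))] with x a1 a2
    rw [a1, Pi.add_apply, a2, Finset.sum_apply, add_mul, Finset.sum_mul]
  have e2 : ∫ x, Ψ x * (-∑ k, particleLaplacian k φ x) =
      ∑ k, ∫ x, Ψ x * (-particleLaplacian k φ x) := by
    rw [← integral_finsetSum _ fun k _ => i4 k]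
    congr 1
    funext x
    rw [← Finset.sum_neg_distrib, Finset.mul_sum]
  have e3 : ∫ x, (potential U V x : ℂ) * Ψ x * φ x =
      ∑ k, (∫ x, (U (x k) : ℂ) * Ψ x * φ x) + ∫ x, Q x * φ x := by
    rw [← integral_finsetSum _ fun k _ => i3 k, ← integral_add
      (integrable_finsetSum _ fun k _ => i3 k) i2]
    refine integral_congr_ae ?_
    filter_upwards [hpot] with x hx
    rw [hx, add_mul, Finset.sum_mul]
  rw [e1, e2, e3, Finset.sum_congr rfl fun k _ => (hk k).2 φ hφ, Finset.sum_add_distrib, add_assoc]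

end ProductDomain

/-! ### Differential inequalities for commutators -/

section Commutators

open Set

variable {𝓗 : Type*} [NormedAddCommGroup 𝓗] [InnerProductSpace ℂ 𝓗]

theorem norm_lie_le (a b : 𝓗 →L[ℂ] 𝓗) : ‖⁅a, b⁆‖ ≤ 2 * ‖a‖ * ‖b‖ := by
  rw [Ring.lie_def]
  refine (norm_sub_le _ _).trans ?_
  have h1 := norm_mul_le a b
  have h2 := norm_mul_le b a
  linarith

theorem norm_mul_mul_le_of_le_one {a b c : 𝓗 →L[ℂ] 𝓗} (ha : ‖a‖ ≤ 1) (hc : ‖c‖ ≤ 1) :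
    ‖a * b * c‖ ≤ ‖b‖ := by
  calc ‖a * b * c‖ ≤ ‖a‖ * ‖b‖ * ‖c‖ := norm_mul₃_le
    _ ≤ 1 * ‖b‖ * 1 := by gcongr
    _ = ‖b‖ := by ring

/-- An operator that commutes with the generators `Q s` of a propagator commutes with the
propagator. -/
theorem commute_of_hasDerivAt {Ω Ω' Q : ℝ → 𝓗 →L[ℂ] 𝓗} (h1 : ∀ s, ‖Ω s‖ ≤ 1)
    (h1' : ∀ s, ‖Ω' s‖ ≤ 1) (h2 : ∀ s, Ω' s * Ω s = 1) (h2' : ∀ s, Ω s * Ω' s = 1)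
    (h3 : ∀ ψ, Continuous fun s => Ω' s ψ) (h0 : Ω 0 = 1)
    (hd : ∀ ψ s, HasDerivAt (fun r => Ω r ψ) ((Complex.I • (Ω s * Q s)) ψ) s)
    {a : 𝓗 →L[ℂ] 𝓗} (ha : ∀ s, Commute a (Q s)) (s : ℝ) : Ω s * a * Ω' s = a := by
  have h0' : Ω' 0 = 1 := by simpa [h0] using h2 0
  ext ψ
  have hinv : ∀ r, HasDerivAt (fun r => Ω' r ψ)
      (-Ω' r ((Complex.I • (Ω r * Q r)) (Ω' r ψ))) r := fun r =>
    hasDerivAt_inverse_apply h1' h2 h2' (hd _ r) (h3 _).continuousAt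
  -- The derivative is `i Ω [Q, a] Ω⁻¹ ψ`, which vanishes by the assumed commutation.
  have hF : ∀ r, HasDerivAt (fun r => Ω r (a (Ω' r ψ))) 0 r := by
    intro r
    have hv := (a.restrictScalars ℝ).hasFDerivAt.comp_hasDerivAt r (hinv r)
    have := hasDerivAt_clm_apply_of_strong (v := fun r => a (Ω' r ψ)) h1 (hd (a (Ω' r ψ)) r)
      (continuous_iff_continuousAt.1 (continuous_iff_continuousAt.2 fun x =>
        (hd _ x).continuousAt) r) hv
    refine this.congr_deriv ?_
    have e1 : ∀ φ, Ω' r (Ω r φ) = φ := fun φ => DFunLike.congr_fun (h2 r) φ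
    have e2 : ∀ φ, a (Q r φ) = Q r (a φ) := fun φ => DFunLike.congr_fun (ha r).eq φ
    change Complex.I • Ω r (Q r (a (Ω' r ψ))) +
      Ω r (a (-Ω' r (Complex.I • Ω r (Q r (Ω' r ψ))))) = 0
    simp only [map_neg, map_smul, e1, e2]
    abel
  have h4 := is_const_of_deriv_eq_zero (fun r => (hF r).differentiableAt)
    (fun r => (hF r).deriv) s 0
  simpa [h0, h0'] using h4

/-- Growth of the commutator of a fixed operator with an operator transported by a propagator. -/
theorem norm_lie_conj_le {Ω Ω' X : ℝ → 𝓗 →L[ℂ] 𝓗} {c : ℂ} (hc : ‖c‖ ≤ 1) (h1 : ∀ s, ‖Ω s‖ ≤ 1)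
    (h1' : ∀ s, ‖Ω' s‖ ≤ 1) (h2 : ∀ s, Ω' s * Ω s = 1) (h2' : ∀ s, Ω s * Ω' s = 1)
    (h3 : ∀ ψ, Continuous fun s => Ω' s ψ) (h0 : Ω 0 = 1)
    (hd : ∀ ψ s, HasDerivAt (fun r => Ω r ψ) ((c • (X s * Ω s)) ψ) s)
    {a b : 𝓗 →L[ℂ] 𝓗} (hab : Commute a b) {φ φ' : ℝ → ℝ} (hφ : ∀ s, HasDerivAt φ (φ' s) s)
    (hφ0 : φ 0 = 0) (hX : ∀ s, 0 ≤ s → 2 * ‖a‖ * ‖⁅X s, b⁆‖ ≤ φ' s) {t : ℝ} (ht : 0 ≤ t) :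
    ‖⁅Ω t * a * Ω' t, b⁆‖ ≤ φ t := by
  have h0' : Ω' 0 = 1 := by simpa [h0] using h2 0
  have hb : ∀ ψ s, HasDerivAt (fun r => Ω' r (b (Ω r ψ)))
      ((-c • (Ω' s * ⁅X s, b⁆ * Ω s)) ψ) s := by
    intro ψ s
    have hv := (b.restrictScalars ℝ).hasFDerivAt.comp_hasDerivAt s (hd ψ s)
    have hi : HasDerivAt (fun r => Ω' r (b (Ω s ψ)))
        (-Ω' s ((c • (X s * Ω s)) (Ω' s (b (Ω s ψ))))) s :=
      hasDerivAt_inverse_apply h1' h2 h2' (hd _ s) (h3 _).continuousAt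
    have := hasDerivAt_clm_apply_of_strong (v := fun r => b (Ω r ψ)) h1' hi
      (h3 _).continuousAt hv
    refine this.congr_deriv ?_
    have e1 : ∀ φ, Ω s (Ω' s φ) = φ := fun φ => DFunLike.congr_fun (h2' s) φ
    rw [Ring.lie_def]
    change -Ω' s (c • X s (Ω s (Ω' s (b (Ω s ψ))))) + Ω' s (b (c • X s (Ω s ψ))) =
      -c • Ω' s (X s (b (Ω s ψ)) - b (X s (Ω s ψ)))
    simp only [map_smul, e1, map_sub, smul_sub, neg_smul]
    abel
  -- Up to conjugation by `Ω` the commutator in question is `[a, Ω⁻¹ b Ω]`. In this form `a` stays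
  -- fixed and the derivative of `Ω⁻¹ b Ω` contains only `[X, b]`.
  have hG : ∀ ψ s, HasDerivAt (fun r => a (Ω' r (b (Ω r ψ))) - Ω' r (b (Ω r (a ψ))))
      ((⁅a, -c • (Ω' s * ⁅X s, b⁆ * Ω s)⁆ : 𝓗 →L[ℂ] 𝓗) ψ) s := by
    intro ψ s
    have hv := (a.restrictScalars ℝ).hasFDerivAt.comp_hasDerivAt s (hb ψ s)
    refine (hv.sub (hb (a ψ) s)).congr_deriv ?_
    rw [Ring.lie_def]
    rfl
  have hnorm : ∀ s, 0 ≤ s → ‖(⁅a, -c • (Ω' s * ⁅X s, b⁆ * Ω s)⁆ : 𝓗 →L[ℂ] 𝓗)‖ ≤ φ' s := by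
    intro s hs
    refine (norm_lie_le _ _).trans (le_trans ?_ (hX s hs))
    gcongr
    rw [norm_smul, norm_neg]
    exact (mul_le_of_le_one_left (norm_nonneg _) hc).trans
      (norm_mul_mul_le_of_le_one (h1' s) (h1 s))
  have key : ‖(⁅a, Ω' t * b * Ω t⁆ : 𝓗 →L[ℂ] 𝓗)‖ ≤ φ t := by
    -- An operator-norm bound needs a nonnegative constant: `φ` starts at `0` and its derivative
    -- dominates a norm.
    have hφt : 0 ≤ φ t := by
      have hm : MonotoneOn φ (Ici 0) := by
        refine monotoneOn_of_hasDerivWithinAt_nonneg (convex_Ici 0)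
          (fun s _ => (hφ s).continuousAt.continuousWithinAt)
          (fun s _ => (hφ s).hasDerivWithinAt) fun s hs => ?_
        rw [interior_Ici] at hs
        exact (norm_nonneg _).trans (hnorm s (le_of_lt hs))
      rw [← hφ0]
      exact hm (by simp) ht ht
    refine ContinuousLinearMap.opNorm_le_bound _ hφt fun ψ => ?_
    have h := image_norm_le_of_norm_deriv_right_le_deriv_boundary (a := 0) (b := t)
      (f := fun r => a (Ω' r (b (Ω r ψ))) - Ω' r (b (Ω r (a ψ))))
      (B := fun r => φ r * ‖ψ‖) (B' := fun r => φ' r * ‖ψ‖)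
      (fun s _ => (hG ψ s).continuousAt.continuousWithinAt)
      (fun s _ => (hG ψ s).hasDerivWithinAt) ?_ (fun s => (hφ s).mul_const _)
      (fun s hs => ContinuousLinearMap.le_of_opNorm_le _ (hnorm s hs.1) ψ)
      (right_mem_Icc.2 ht)
    · rw [Ring.lie_def]
      exact h
    · have e : a (b ψ) = b (a ψ) := DFunLike.congr_fun hab.eq ψ
      simp [h0, h0', e, hφ0]
  have e2 : ⁅Ω t * a * Ω' t, b⁆ = Ω t * ⁅a, Ω' t * b * Ω t⁆ * Ω' t := by
    have e3 := h2' t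
    simp only [Ring.lie_def, mul_sub, sub_mul]
    have e4 : Ω t * (a * (Ω' t * b * Ω t)) * Ω' t = Ω t * a * Ω' t * b * (Ω t * Ω' t) := by
      noncomm_ring
    have e5 : Ω t * (Ω' t * b * Ω t * a) * Ω' t = (Ω t * Ω' t) * (b * (Ω t * a * Ω' t)) := by
      noncomm_ring
    rw [e4, e5, e3, mul_one, one_mul]
  rw [e2]
  exact (norm_mul_mul_le_of_le_one (h1 t) (h1' t)).trans key

end Commutators

/-! ### Comparison of two dynamics -/

section Propagators

variable {𝓗 : Type*} [NormedAddCommGroup 𝓗] [InnerProductSpace ℂ 𝓗]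

/-- The propagator `W(-s) T(s)` is generated by `T(-s) Q T(s)`. If `a` commutes with all of these,
it commutes with the propagator, so both dynamics move `a` alike. -/
theorem conj_eq_conj_of_hasDerivAt {H : 𝓗 →ₗ.[ℂ] 𝓗} {W T : ℝ → 𝓗 →L[ℂ] 𝓗}
    (hW : IsUnitaryGroup H W) (h1 : ∀ s, ‖T s‖ ≤ 1) (h2 : ∀ s, T s * T (-s) = 1)
    (h2' : ∀ s, T (-s) * T s = 1) (h3 : ∀ ψ, Continuous fun s => T s ψ) (h0 : T 0 = 1)
    {a Q : 𝓗 →L[ℂ] 𝓗}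
    (hd : ∀ ψ s, HasDerivAt (fun r => (W (-r) * T r) ψ)
      ((Complex.I • (W (-s) * Q * T s)) ψ) s)
    (ha : ∀ s, Commute a (T (-s) * Q * T s)) (t : ℝ) :
    W t * a * W (-t) = T t * a * T (-t) := by
  have e1 : ∀ s x, T s * (T (-s) * x) = x := fun s x => by rw [← mul_assoc, h2, one_mul]
  have e2 : ∀ s x, W s * (W (-s) * x) = x := fun s x => by rw [← mul_assoc, hW.mul_neg, one_mul]
  have key := commute_of_hasDerivAt (Ω := fun s => W (-s) * T s) (Ω' := fun s => T (-s) * W s)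
    (Q := fun s => T (-s) * Q * T s)
    (fun s => (norm_mul_le _ _).trans (mul_le_one₀ (hW.norm_le _) (norm_nonneg _) (h1 s)))
    (fun s => (norm_mul_le _ _).trans (mul_le_one₀ (h1 _) (norm_nonneg _) (hW.norm_le _)))
    (fun s => by rw [mul_assoc, e2, h2'])
    (fun s => by rw [mul_assoc, e1, hW.neg_mul])
    (fun ψ => continuous_clm_apply_of_strong (T := fun s => T (-s)) (C := 1) (fun s => h1 _)
      (fun φ => (h3 φ).comp continuous_neg) (hW.continuous ψ))
    (by simp only [neg_zero]; rw [hW.zero, h0, one_mul])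
    (fun ψ s => (hd ψ s).congr_deriv (by simp only [mul_assoc, e1])) ha t
  rw [← congrArg (fun x => W t * x * W (-t)) key]
  simp only [mul_assoc, e2]
  rw [hW.mul_neg, mul_one]

/-- The commutator of `b` with the evolution of `a` under a Hamiltonian `H`, in terms of the
evolution of the difference `Q` of `H` to a Hamiltonian whose evolution of `a` commutes
with `b`. -/
theorem norm_lie_evolution_le [CompleteSpace 𝓗] {H H' : 𝓗 →ₗ.[ℂ] 𝓗} {W W' : ℝ → 𝓗 →L[ℂ] 𝓗}
    (hW : IsUnitaryGroup H W) (hW' : IsUnitaryGroup H' W') (hs : IsSelfAdjoint H')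
    {Q : 𝓗 →L[ℂ] 𝓗} (hQ : ∀ ψ χ, (ψ, χ) ∈ H'.graph ↔ (ψ, χ + Q ψ) ∈ H.graph)
    {σ : ℝ} (hσ : |σ| ≤ 1) {a b : 𝓗 →L[ℂ] 𝓗} {t : ℝ} (ht : 0 ≤ t)
    (hab : Commute (W' (-(σ * t)) * a * W' (σ * t)) b) {φ φ' : ℝ → ℝ}
    (hφ : ∀ s, HasDerivAt φ (φ' s) s) (hφ0 : φ 0 = 0)
    (hX : ∀ s, 0 ≤ s → 2 * ‖a‖ * ‖⁅W (-(σ * s)) * Q * W (σ * s), b⁆‖ ≤ φ' s) :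
    ‖⁅W (-(σ * t)) * a * W (σ * t), b⁆‖ ≤ φ t := by
  have e1 : ∀ s x, W s * (W (-s) * x) = x := fun s x => by rw [← mul_assoc, hW.mul_neg, one_mul]
  have e2 : ∀ s x, W' s * (W' (-s) * x) = x := fun s x => by
    rw [← mul_assoc, hW'.mul_neg, one_mul]
  have hd : ∀ ψ s, HasDerivAt (fun r => (W (-r) * W' r) ψ)
      ((Complex.I • (W (-s) * Q * W' s)) ψ) s :=
    hW.hasDerivAt_wave hW'.norm_le Q (D := {ψ | ∃ χ, (ψ, χ) ∈ H'.graph})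
      ((dense_fst_graph hs).mono Submodule.subset_span) (by
        rintro ψ ⟨χ, h⟩ s
        exact ⟨_, hW'.hasDerivAt h s, (hQ _ _).1 (hW'.mem_graph h s)⟩)
  have hm : ∀ s, HasDerivAt (fun r => σ * r) σ s := fun s => by
    simpa using (hasDerivAt_id s).const_mul σ
  -- The operator put in for `a` is `W'(-σt) a W'(σt)` at the final time `t`: `Ω t` conjugates it
  -- into `W(-σt) a W(σt)`, and its norm is at most `‖a‖`.
  have key := norm_lie_conj_le (c := σ * Complex.I) (Ω := fun s => W (-(σ * s)) * W' (σ * s))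
    (Ω' := fun s => W' (-(σ * s)) * W (σ * s)) (X := fun s => W (-(σ * s)) * Q * W (σ * s))
    (by simpa using hσ)
    (fun s => (norm_mul_le _ _).trans (mul_le_one₀ (hW.norm_le _) (norm_nonneg _) (hW'.norm_le _)))
    (fun s => (norm_mul_le _ _).trans (mul_le_one₀ (hW'.norm_le _) (norm_nonneg _) (hW.norm_le _)))
    (fun s => by rw [mul_assoc, e1, hW'.neg_mul])
    (fun s => by rw [mul_assoc, e2, hW.neg_mul])
    (fun ψ => continuous_clm_apply_of_strong (T := fun s => W' (-(σ * s))) (C := 1)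
      (fun s => hW'.norm_le _)
      (fun φ => (hW'.continuous φ).comp (continuous_const.mul continuous_id).neg)
      ((hW.continuous ψ).comp (continuous_const.mul continuous_id)))
    (by simp only [mul_zero, neg_zero]; rw [hW.zero, hW'.zero, one_mul])
    (fun ψ s => ((hd ψ (σ * s)).scomp s (hm s)).congr_deriv (by
      have e : W (-(σ * s)) * Q * W (σ * s) * (W (-(σ * s)) * W' (σ * s)) =
          W (-(σ * s)) * Q * W' (σ * s) := by simp only [mul_assoc, e1]
      rw [e, mul_smul]
      rfl))
    hab hφ hφ0 (fun s h => le_trans (by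
      have := norm_mul_mul_le_of_le_one (b := a) (hW'.norm_le (-(σ * t))) (hW'.norm_le (σ * t))
      gcongr) (hX s h)) ht
  simpa only [mul_assoc, e2] using key

end Propagators

/-! ### The free evolution and local operators -/

section FreeEvolution

variable {ν N : ℕ} {ι : Type} [Fintype ι] {H₁ : L2 ν (Fin 1) →ₗ.[ℂ] L2 ν (Fin 1)}
  {u : ℝ → L2 ν (Fin 1) →L[ℂ] L2 ν (Fin 1)}

theorem continuous_tensorPower_apply (hu : IsUnitaryGroup H₁ u) (ψ : L2 ν ι) :
    Continuous fun s => tensorPower ι (u s) ψ := by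
  refine continuous_apply_of_dense (C := 1) (fun s => norm_tensorPower_le (hu.norm_le s))
    (dense_span_prodState (ι := ι) dense_univ) ?_ ψ
  rintro _ ⟨f, -, rfl⟩
  simp only [tensorPower_prodState]
  exact continuous_prodState.comp (continuous_pi fun k => hu.continuous (f k))

theorem tensorPower_mul_neg (hu : IsUnitaryGroup H₁ u) (s : ℝ) :
    tensorPower ι (u s) * tensorPower ι (u (-s)) = 1 := by
  rw [← tensorPower_mul, hu.mul_neg, tensorPower_one]

theorem tensorPower_neg_mul (hu : IsUnitaryGroup H₁ u) (s : ℝ) :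
    tensorPower ι (u (-s)) * tensorPower ι (u s) = 1 := by
  rw [← tensorPower_mul, hu.neg_mul, tensorPower_one]

theorem tensorPower_zero (hu : IsUnitaryGroup H₁ u) : tensorPower ι (u 0) = 1 := by
  rw [hu.zero, tensorPower_one]

/-- The free evolution of a product state of domain vectors. -/
theorem hasDerivAt_tensorPower_prodState [DecidableEq ι] (hu : IsUnitaryGroup H₁ u) {f g : ι → L2 ν (Fin 1)}
    (h : ∀ k, (f k, g k) ∈ H₁.graph) (s : ℝ) :
    HasDerivAt (fun r => tensorPower ι (u r) (prodState f))
      (-Complex.I • ∑ k, prodState (Function.update (fun l => u s (f l)) k (u s (g k)))) s := by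
  simp only [tensorPower_prodState]
  have h1 : HasDerivAt (fun r k => u r (f k)) (fun k => -Complex.I • u s (g k)) s :=
    hasDerivAt_pi.2 fun k => hu.hasDerivAt (h k) s
  have h2 := ((prodStateMultilinear (ν := ν) (ι := ι)).hasFDerivAt
    fun k => u s (f k)).restrictScalars ℝ
  refine (h2.comp_hasDerivAt s h1).congr_deriv ?_
  change (prodStateMultilinear (ν := ν) (ι := ι)).linearDeriv (fun k => u s (f k))
    (fun k => -Complex.I • u s (g k)) = _
  rw [ContinuousMultilinearMap.linearDeriv_apply, Finset.smul_sum]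
  refine Finset.sum_congr rfl fun k _ => ?_
  rw [ContinuousMultilinearMap.map_update_smul, prodStateMultilinear_apply]

theorem norm_onParticles_le {m : ℕ} (i : Fin m ↪o Fin N) (A : L2 ν (Fin m) →L[ℂ] L2 ν (Fin m)) :
    ‖onParticles i A‖ ≤ ‖A‖ := by
  rw [onParticles_eq_amp]
  exact norm_amp_le _ _

theorem commute_onParticles {m n : ℕ} (i : Fin m ↪o Fin N) (j : Fin n ↪o Fin N)
    (hij : Disjoint (Set.range i) (Set.range j)) (A : L2 ν (Fin m) →L[ℂ] L2 ν (Fin m))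
    (B : L2 ν (Fin n) →L[ℂ] L2 ν (Fin n)) : Commute (onParticles i A) (onParticles j B) := by
  rw [onParticles_eq_amp, onParticles_eq_amp]
  exact commute_amp_of_disjoint _ _
    (fun a b h => Set.disjoint_left.1 hij ⟨a, rfl⟩ ⟨b, h.symm⟩) A B

theorem tensorPower_mul_onParticles_mul {m : ℕ}
    {u v : L2 ν (Fin 1) →L[ℂ] L2 ν (Fin 1)} (huv : u * v = 1) (i : Fin m ↪o Fin N)
    (A : L2 ν (Fin m) →L[ℂ] L2 ν (Fin m)) :
    tensorPower (Fin N) u * onParticles i A * tensorPower (Fin N) v =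
      onParticles i (tensorPower (Fin m) u * A * tensorPower (Fin m) v) := by
  rw [onParticles_eq_amp, onParticles_eq_amp]
  exact tensorPower_mul_amp_mul _ huv A

/-- The embedding of the pair `k < l`. -/
def pairEmbedding {k l : Fin N} (h : k < l) : Fin 2 ↪o Fin N :=
  OrderEmbedding.ofStrictMono ![k, l] (by
    intro a b hab
    fin_cases a <;> fin_cases b <;> simp_all)

theorem range_pairEmbedding {k l : Fin N} (h : k < l) :
    Set.range (pairEmbedding h) = {k, l} := by
  change Set.range ![k, l] = _
  simp [Matrix.range_cons, Set.pair_comm]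

theorem pairOp_eq_onParticles (V : Lp ℝ ⊤ (volume : Measure (Space ν))) {k l : Fin N}
    (h : k < l) : pairOp V k l = onParticles (pairEmbedding h) (pairOp V 0 1) := by
  rw [onParticles_eq_amp]
  exact pairOp_eq_amp V (sumOfEmbedding (pairEmbedding h).toEmbedding) 0 1

end FreeEvolution

/-! ### Decoupling of a set of particles -/

section Locality

variable {ν N m : ℕ} {U : Space ν → ℝ} {V : Lp ℝ ⊤ (volume : Measure (Space ν))}

/-- The pairs `k < l` that contain an element of `s`. -/
def pairsMeeting (s : Finset (Fin N)) : Finset (Fin N × Fin N) :=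
  {p ∈ allPairs N | p.1 ∈ s ∨ p.2 ∈ s}

theorem pairSum_allPairs_eq_add (s : Finset (Fin N)) :
    pairSum V (allPairs N) =
      pairSum V (allPairs N \ pairsMeeting s) + pairSum V (pairsMeeting s) := by
  rw [pairSum, pairSum, pairSum, ← smul_add,
    Finset.sum_sdiff (s₁ := pairsMeeting s) (Finset.filter_subset _ _)]

/-- Without the interaction of the particles `i` with all particles, an operator on the particles
`i` evolves as under the free evolution. -/
theorem conj_onParticles_eq {u : ℝ → L2 ν (Fin 1) →L[ℂ] L2 ν (Fin 1)}
    (h₁ : IsSelfAdjoint (hamiltonian U V 1)) (hu : IsUnitaryGroup (hamiltonian U V 1) u)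
    (i : Fin m ↪o Fin N) {H' : L2 ν (Fin N) →ₗ.[ℂ] L2 ν (Fin N)}
    (hH' : ∀ ψ χ, (ψ, χ) ∈ H'.graph ↔
      (ψ, χ + pairSum V (pairsMeeting (Finset.univ.image i)) ψ) ∈ (hamiltonian U V N).graph)
    {W' : ℝ → L2 ν (Fin N) →L[ℂ] L2 ν (Fin N)} (hW' : IsUnitaryGroup H' W')
    (A : L2 ν (Fin m) →L[ℂ] L2 ν (Fin m)) (t : ℝ) :
    W' t * onParticles i A * W' (-t) =
      onParticles i (tensorPower (Fin m) (u t) * A * tensorPower (Fin m) (u (-t))) := by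
  set S := pairsMeeting (Finset.univ.image i) with hS
  set Q := pairSum V (allPairs N \ S) with hQ
  -- On product states of domain vectors the free evolution is generated by `H' - Q`, where `Q`
  -- collects the interactions that `H'` still contains.
  have hd : ∀ ψ s, HasDerivAt (fun r => (W' (-r) * tensorPower (Fin N) (u r)) ψ)
      ((Complex.I • (W' (-s) * Q * tensorPower (Fin N) (u s))) ψ) s := by
    refine hW'.hasDerivAt_wave (fun s => norm_tensorPower_le (hu.norm_le s)) Q
      (dense_span_prodState (dense_fst_graph h₁)) ?_
    rintro _ ⟨f, hf, rfl⟩ s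
    choose g hg using hf
    refine ⟨_, hasDerivAt_tensorPower_prodState hu hg s, ?_⟩
    rw [hH', tensorPower_prodState, add_assoc]
    have h := prodState_mem_graph U V _ _ fun k => hu.mem_graph (hg k) s
    rw [pairSum_allPairs_eq_add (Finset.univ.image i)] at h
    exact h
  -- Every pair in `Q` avoids the particles `i`, and free conjugation keeps each term on its pair.
  have hcomm : ∀ s, Commute (onParticles i A)
      (tensorPower (Fin N) (u (-s)) * Q * tensorPower (Fin N) (u s)) := by
    intro s
    rw [hQ, pairSum, mul_smul_comm, smul_mul_assoc, Finset.mul_sum, Finset.sum_mul]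
    refine Commute.smul_right (Commute.sum_right _ _ _ fun p hp => ?_) _
    obtain ⟨hp1, hp2⟩ := Finset.mem_sdiff.1 hp
    have hlt : p.1 < p.2 := (Finset.mem_filter.1 hp1).2
    rw [pairOp_eq_onParticles V hlt, tensorPower_mul_onParticles_mul (hu.neg_mul s)]
    refine commute_onParticles _ _ ?_ _ _
    rw [range_pairEmbedding, Set.disjoint_left]
    rintro _ ⟨a, rfl⟩ ha
    refine hp2 (Finset.mem_filter.2 ⟨hp1, ?_⟩)
    rcases ha with ha | ha
    · exact Or.inl (Finset.mem_image.2 ⟨a, Finset.mem_univ _, ha⟩)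
    · exact Or.inr (Finset.mem_image.2 ⟨a, Finset.mem_univ _, ha⟩)
  rw [conj_eq_conj_of_hasDerivAt hW' (fun s => norm_tensorPower_le (hu.norm_le s))
    (tensorPower_mul_neg hu) (tensorPower_neg_mul hu) (continuous_tensorPower_apply hu)
    (tensorPower_zero hu) hd hcomm t]
  exact tensorPower_mul_onParticles_mul (hu.mul_neg t) i A

end Locality

/-! ### Counting the pairs -/

section Counting

variable {N : ℕ}

/-- Each pair is oriented to lie in `s × t`. This is injective because a pair and its swap cannot
both be increasing. -/
theorem card_filter_pairs_le {P : Finset (Fin N × Fin N)} {s t : Finset (Fin N)}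
    (hlt : ∀ p ∈ P, p.1 < p.2) (h : ∀ p ∈ P, p ∈ s ×ˢ t ∨ p.swap ∈ s ×ˢ t) :
    P.card ≤ s.card * t.card := by
  rw [← Finset.card_product]
  refine Finset.card_le_card_of_injOn (fun p => if p ∈ s ×ˢ t then p else p.swap) ?_ ?_
  · intro p hp
    change (if p ∈ s ×ˢ t then p else p.swap) ∈ s ×ˢ t
    split_ifs with hs
    · exact hs
    · exact (h p hp).resolve_left hs
  · rintro ⟨k, l⟩ hp ⟨k', l'⟩ hq hpq
    have h1 : k < l := hlt _ hp
    have h2 : k' < l' := hlt _ hq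
    dsimp only at hpq
    split_ifs at hpq <;> simp only [Prod.swap_prod_mk, Prod.mk.injEq] at hpq ⊢ <;> omega

theorem card_pairsMeeting_le (s : Finset (Fin N)) : (pairsMeeting s).card ≤ s.card * N := by
  have h := card_filter_pairs_le (P := pairsMeeting s) (s := s) (t := Finset.univ)
    (fun p hp => (Finset.mem_filter.1 (Finset.mem_filter.1 hp).1).2)
    (fun p hp => by simpa using (Finset.mem_filter.1 hp).2)
  simpa using h

theorem card_pairsMeeting_filter_le {s t : Finset (Fin N)} (hst : Disjoint s t) :
    {p ∈ pairsMeeting s | p.1 ∈ t ∨ p.2 ∈ t}.card ≤ s.card * t.card := by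
  refine card_filter_pairs_le
    (fun p hp => (Finset.mem_filter.1 (Finset.mem_filter.1 (Finset.mem_filter.1 hp).1).1).2)
    fun p hp => ?_
  obtain ⟨hp, ht⟩ := Finset.mem_filter.1 hp
  have hs := (Finset.mem_filter.1 hp).2
  have h1 : p.1 ∈ s → p.1 ∉ t := fun h => Finset.disjoint_left.1 hst h
  have h2 : p.2 ∈ s → p.2 ∉ t := fun h => Finset.disjoint_left.1 hst h
  simp only [Finset.mem_product, Prod.fst_swap, Prod.snd_swap]
  tauto

end Counting

/-! ### Iteration of the commutator bound -/

section Propagation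

theorem lie_conj_smul_sum {R : Type*} [Ring R] [Algebra ℂ R] {κ : Type*} (s : Finset κ)
    (c : ℂ) (x : κ → R) (w w' b : R) :
    ⁅w * (c • ∑ p ∈ s, x p) * w', b⁆ = c • ∑ p ∈ s, ⁅w * x p * w', b⁆ := by
  simp only [Ring.lie_def, mul_smul_comm, smul_mul_assoc, Finset.mul_sum, Finset.sum_mul,
    Finset.sum_sub_distrib, smul_sub]

variable {ν N m n : ℕ} {U : Space ν → ℝ} {V : Lp ℝ ⊤ (volume : Measure (Space ν))}
  {W : ℝ → L2 ν (Fin N) →L[ℂ] L2 ν (Fin N)}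

/-- The mean-field scaling enters here. Pairs meeting both sets number at most `|s||t|` and remain
of order `1/N`; the `|s| N` pairs meeting `s` use up the factor `1/N` and leave `γ`. -/
theorem norm_lie_conj_pairSum_le {w w' b : L2 ν (Fin N) →L[ℂ] L2 ν (Fin N)} (hw : ‖w‖ ≤ 1)
    (hw' : ‖w'‖ ≤ 1) {s t : Finset (Fin N)} (hst : Disjoint s t) {γ : ℝ} (hγ0 : 0 ≤ γ)
    (hγ : ∀ p ∈ allPairs N, p.1 ∉ t → p.2 ∉ t → ‖⁅w * pairOp V p.1 p.2 * w', b⁆‖ ≤ ‖V‖ * γ) :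
    ‖⁅w * pairSum V (pairsMeeting s) * w', b⁆‖ ≤
      s.card * ‖V‖ * (2 * t.card * ‖b‖ / N + γ) := by
  have hV := norm_nonneg V
  have hb := norm_nonneg b
  have h1 : ∀ p ∈ pairsMeeting s, ‖⁅w * pairOp V p.1 p.2 * w', b⁆‖ ≤
      (if p.1 ∈ t ∨ p.2 ∈ t then 2 * ‖V‖ * ‖b‖ else 0) + ‖V‖ * γ := by
    intro p hp
    split_ifs with h
    · have h2 := (norm_mul_mul_le_of_le_one hw hw').trans (norm_pairOp_le V p.1 p.2)
      have h3 := norm_lie_le (w * pairOp V p.1 p.2 * w') b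
      have h4 : 2 * ‖w * pairOp V p.1 p.2 * w'‖ * ‖b‖ ≤ 2 * ‖V‖ * ‖b‖ := by gcongr
      have h5 : 0 ≤ ‖V‖ * γ := by positivity
      linarith
    · rw [not_or] at h
      rw [zero_add]
      exact hγ p (Finset.mem_filter.1 hp).1 h.1 h.2
  have h2 : ⁅w * pairSum V (pairsMeeting s) * w', b⁆ =
      (1 / N : ℂ) • ∑ p ∈ pairsMeeting s, ⁅w * pairOp V p.1 p.2 * w', b⁆ :=
    lie_conj_smul_sum _ _ _ _ _ _
  have h3 : (({p ∈ pairsMeeting s | p.1 ∈ t ∨ p.2 ∈ t}.card : ℕ) : ℝ) ≤ s.card * t.card := by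
    exact_mod_cast card_pairsMeeting_filter_le hst
  have h4 : ((pairsMeeting s).card : ℝ) ≤ s.card * N := by exact_mod_cast card_pairsMeeting_le s
  -- For `N = 0` the quotient is `0` by convention, but then `s` is empty.
  have hN : (s.card : ℝ) * (N / N) = s.card := by
    rcases eq_or_ne N 0 with rfl | h
    · simp [Finset.eq_empty_of_isEmpty s]
    · rw [div_self (by exact_mod_cast h), mul_one]
  rw [h2, norm_smul]
  have h5 : ‖(1 / N : ℂ)‖ = 1 / N := by simp
  rw [h5]
  calc (1 / N : ℝ) * ‖∑ p ∈ pairsMeeting s, ⁅w * pairOp V p.1 p.2 * w', b⁆‖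
      ≤ (1 / N : ℝ) * ∑ p ∈ pairsMeeting s,
          ((if p.1 ∈ t ∨ p.2 ∈ t then 2 * ‖V‖ * ‖b‖ else 0) + ‖V‖ * γ) := by
        gcongr
        exact norm_sum_le_of_le _ h1
    _ = (1 / N : ℝ) * ((({p ∈ pairsMeeting s | p.1 ∈ t ∨ p.2 ∈ t}.card : ℕ) : ℝ) *
          (2 * ‖V‖ * ‖b‖) + (pairsMeeting s).card * (‖V‖ * γ)) := by
        rw [Finset.sum_add_distrib, ← Finset.sum_filter, Finset.sum_const, Finset.sum_const,
          nsmul_eq_mul, nsmul_eq_mul]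
    _ ≤ (1 / N : ℝ) * (s.card * t.card * (2 * ‖V‖ * ‖b‖) + s.card * N * (‖V‖ * γ)) := by
        gcongr
    _ = s.card * ‖V‖ * (2 * t.card * ‖b‖ / N) + s.card * (N / N) * (‖V‖ * γ) := by ring
    _ = s.card * ‖V‖ * (2 * t.card * ‖b‖ / N + γ) := by
        rw [hN]
        ring

/-- One step of the iteration: a bound `‖V‖ γ` for pairs away from `j` yields a bound `φ` for every
operator away from `j`. A majorant with prescribed derivative takes the place of an integral. -/
theorem norm_lie_evolution_onParticles_le (h₁ : IsSelfAdjoint (hamiltonian U V 1))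
    (hN : IsSelfAdjoint (hamiltonian U V N)) (hW : IsUnitaryGroup (hamiltonian U V N) W)
    (i : Fin m ↪o Fin N) (j : Fin n ↪o Fin N) (hij : Disjoint (Set.range i) (Set.range j))
    (A : L2 ν (Fin m) →L[ℂ] L2 ν (Fin m)) (B : L2 ν (Fin n) →L[ℂ] L2 ν (Fin n)) {σ : ℝ}
    (hσ : |σ| ≤ 1) {γ φ : ℝ → ℝ} (hγ0 : ∀ s, 0 ≤ s → 0 ≤ γ s)
    (hγ : ∀ s, 0 ≤ s → ∀ p ∈ allPairs N, p.1 ∉ Set.range j → p.2 ∉ Set.range j →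
      ‖⁅W (-(σ * s)) * pairOp V p.1 p.2 * W (σ * s), onParticles j B⁆‖ ≤ ‖V‖ * γ s)
    (hφ : ∀ s, HasDerivAt φ (2 * ‖A‖ * (m * ‖V‖ * (2 * n * ‖B‖ / N + γ s))) s)
    (hφ0 : φ 0 = 0) {t : ℝ} (ht : 0 ≤ t) :
    ‖⁅W (-(σ * t)) * onParticles i A * W (σ * t), onParticles j B⁆‖ ≤ φ t := by
  obtain ⟨u, hu⟩ := exists_isUnitaryGroup h₁
  obtain ⟨H', hs, hQ⟩ := exists_isSelfAdjoint_sub hN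
    (pairSum V (pairsMeeting (Finset.univ.image i))) (inner_pairSum V _)
  obtain ⟨W', hW'⟩ := exists_isUnitaryGroup hs
  refine norm_lie_evolution_le hW hW' hs hQ hσ ht ?_ hφ hφ0 fun s h0 => ?_
  · have h := conj_onParticles_eq h₁ hu i hQ hW' A (-(σ * t))
    rw [neg_neg] at h
    rw [h]
    exact commute_onParticles i j hij _ _
  · have hd : Disjoint (Finset.univ.image i) (Finset.univ.image j) := by
      rw [← Finset.disjoint_coe]
      simpa using hij
    have h := norm_lie_conj_pairSum_le (V := V) (hW.norm_le (-(σ * s))) (hW.norm_le (σ * s)) hd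
      (hγ0 s h0) (b := onParticles j B)
      fun p hp h1 h2 => hγ s h0 p hp (by simpa using h1) (by simpa using h2)
    rw [Finset.card_image_of_injective _ i.injective, Finset.card_image_of_injective _ j.injective,
      Finset.card_univ, Finset.card_univ, Fintype.card_fin, Fintype.card_fin] at h
    have hγs := hγ0 s h0
    refine mul_le_mul (by gcongr; exact norm_onParticles_le i A) (h.trans ?_) (norm_nonneg _)
      (by positivity)
    gcongr
    exact norm_onParticles_le j B

/-- The bound on commutators after `p` iterations: the limit plus a remainder. -/
def iteratedBound (a b c : ℝ) (p : ℕ) (s : ℝ) : ℝ :=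
  a * (Real.exp (c * s) - 1) + b * ((c * s) ^ p / p.factorial)

theorem iteratedBound_nonneg {a b c s : ℝ} (ha : 0 ≤ a) (hb : 0 ≤ b) (hc : 0 ≤ c) (hs : 0 ≤ s)
    (p : ℕ) : 0 ≤ iteratedBound a b c p s := by
  have h : 0 ≤ Real.exp (c * s) - 1 := by
    have := Real.one_le_exp (mul_nonneg hc hs)
    linarith
  unfold iteratedBound
  positivity

/-- The exponential part is a fixed point of the recursion `f ↦ c ∫ (a + f)`, while the remainder
gains one order in `s`. -/
theorem hasDerivAt_iteratedBound (a b c : ℝ) (p : ℕ) (s : ℝ) :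
    HasDerivAt (iteratedBound a b c (p + 1)) (c * (a + iteratedBound a b c p s)) s := by
  have h0 : HasDerivAt (fun r => c * r) c s := by simpa using (hasDerivAt_id s).const_mul c
  refine ((((h0.exp).sub_const 1).const_mul a).add
    (((h0.pow (p + 1)).div_const ((p + 1).factorial : ℝ)).const_mul b)).congr_deriv ?_
  have hp : ((p.factorial : ℕ) : ℝ) ≠ 0 := by exact_mod_cast p.factorial_ne_zero
  have hp' : (p : ℝ) + 1 ≠ 0 := by positivity
  unfold iteratedBound
  rw [Nat.factorial_succ]
  push_cast
  field_simp
  ring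

/-- The prefactor `m‖A‖/2` is at most `‖V‖` when `A` is a pair interaction (`m = 2`), so each bound
has the form that the next step takes as input. -/
theorem norm_lie_evolution_onParticles_le_iteratedBound (h₁ : IsSelfAdjoint (hamiltonian U V 1))
    (hN : IsSelfAdjoint (hamiltonian U V N)) (hW : IsUnitaryGroup (hamiltonian U V N) W)
    (j : Fin n ↪o Fin N) (B : L2 ν (Fin n) →L[ℂ] L2 ν (Fin n)) {σ : ℝ} (hσ : |σ| ≤ 1) (q : ℕ)
    {m : ℕ} (i : Fin m ↪o Fin N) (hij : Disjoint (Set.range i) (Set.range j))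
    (A : L2 ν (Fin m) →L[ℂ] L2 ν (Fin m)) {t : ℝ} (ht : 0 ≤ t) :
    ‖⁅W (-(σ * t)) * onParticles i A * W (σ * t), onParticles j B⁆‖ ≤
      m * ‖A‖ / 2 * iteratedBound (2 * n * ‖B‖ / N) (2 * ‖B‖) (4 * ‖V‖) (q + 1) t := by
  have hγ0 : ∀ p s, 0 ≤ s → 0 ≤ iteratedBound (2 * n * ‖B‖ / N) (2 * ‖B‖) (4 * ‖V‖) p s :=
    fun p s hs => iteratedBound_nonneg (by positivity) (by positivity) (by positivity) hs p
  have step : ∀ p, (∀ s, 0 ≤ s → ∀ k ∈ allPairs N, k.1 ∉ Set.range j → k.2 ∉ Set.range j →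
      ‖⁅W (-(σ * s)) * pairOp V k.1 k.2 * W (σ * s), onParticles j B⁆‖ ≤
        ‖V‖ * iteratedBound (2 * n * ‖B‖ / N) (2 * ‖B‖) (4 * ‖V‖) p s) →
      ∀ {m : ℕ} (i : Fin m ↪o Fin N), Disjoint (Set.range i) (Set.range j) →
      ∀ (A : L2 ν (Fin m) →L[ℂ] L2 ν (Fin m)) {t : ℝ}, 0 ≤ t →
      ‖⁅W (-(σ * t)) * onParticles i A * W (σ * t), onParticles j B⁆‖ ≤
        m * ‖A‖ / 2 * iteratedBound (2 * n * ‖B‖ / N) (2 * ‖B‖) (4 * ‖V‖) (p + 1) t := by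
    intro p hp m i hij A t ht
    refine norm_lie_evolution_onParticles_le h₁ hN hW i j hij A B hσ (hγ0 p) hp
      (φ := fun s => m * ‖A‖ / 2 *
        iteratedBound (2 * n * ‖B‖ / N) (2 * ‖B‖) (4 * ‖V‖) (p + 1) s) (fun s => ?_) ?_ ht
    · refine ((hasDerivAt_iteratedBound _ _ _ p s).const_mul _).congr_deriv ?_
      ring
    · simp [iteratedBound]
  refine step q ?_ i hij A ht
  clear hij ht
  induction q with
  -- At order `0` the remainder is the constant `2‖B‖`, which already covers the trivial bound
  -- `2‖V‖‖B‖`.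
  | zero =>
    intro s hs k _ _ _
    refine (norm_lie_le _ _).trans ?_
    have h1 := (norm_mul_mul_le_of_le_one (hW.norm_le (-(σ * s))) (hW.norm_le (σ * s))).trans
      (norm_pairOp_le V k.1 k.2)
    have h2 := norm_onParticles_le j B
    have h3 : 0 ≤ ‖V‖ * (2 * n * ‖B‖ / N * (Real.exp (4 * ‖V‖ * s) - 1)) := by
      have := Real.one_le_exp (show 0 ≤ 4 * ‖V‖ * s by positivity)
      have : 0 ≤ Real.exp (4 * ‖V‖ * s) - 1 := by linarith
      positivity
    calc 2 * ‖W (-(σ * s)) * pairOp V k.1 k.2 * W (σ * s)‖ * ‖onParticles j B‖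
        ≤ 2 * ‖V‖ * ‖B‖ := by gcongr
      _ ≤ _ := by
        simp only [iteratedBound, pow_zero, Nat.factorial_zero, Nat.cast_one, div_one, mul_one]
        linarith
  | succ q ih =>
    intro s hs k hk h1 h2
    have hlt : k.1 < k.2 := (Finset.mem_filter.1 hk).2
    rw [pairOp_eq_onParticles V hlt]
    refine (step q ih (pairEmbedding hlt) ?_ _ hs).trans ?_
    · rw [range_pairEmbedding, Set.disjoint_left]
      rintro x (rfl | rfl) <;> assumption
    · refine mul_le_mul_of_nonneg_right ?_ (hγ0 _ s hs)
      have := norm_pairOp_le V (0 : Fin 2) 1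
      push_cast
      linarith

/-- Propagation bound for the mean field dynamics, for the forward and the backward evolution. -/
theorem norm_lie_evolution_onParticles_le_exp (h₁ : IsSelfAdjoint (hamiltonian U V 1))
    (hN : IsSelfAdjoint (hamiltonian U V N)) (hW : IsUnitaryGroup (hamiltonian U V N) W)
    (i : Fin m ↪o Fin N) (j : Fin n ↪o Fin N) (hij : Disjoint (Set.range i) (Set.range j))
    (A : L2 ν (Fin m) →L[ℂ] L2 ν (Fin m)) (B : L2 ν (Fin n) →L[ℂ] L2 ν (Fin n)) (t : ℝ) :
    ‖⁅W (-t) * onParticles i A * W t, onParticles j B⁆‖ ≤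
      m * n * ‖A‖ * ‖B‖ / N * (Real.exp (4 * ‖V‖ * |t|) - 1) := by
  -- The sign of `t` goes into `σ`, so the iteration runs over the nonnegative time `|t|` in both
  -- directions.
  obtain ⟨σ, hσ, hσt⟩ : ∃ σ : ℝ, |σ| ≤ 1 ∧ σ * |t| = t := by
    rcases abs_choice t with h | h
    · exact ⟨1, by simp, by rw [one_mul, h]⟩
    · exact ⟨-1, by simp, by rw [h]; ring⟩
  have hlim : Filter.Tendsto (fun q : ℕ => m * ‖A‖ / 2 *
      iteratedBound (2 * n * ‖B‖ / N) (2 * ‖B‖) (4 * ‖V‖) (q + 1) |t|) Filter.atTop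
      (nhds (m * ‖A‖ / 2 * (2 * n * ‖B‖ / N * (Real.exp (4 * ‖V‖ * |t|) - 1) + 2 * ‖B‖ * 0))) :=
    ((((FloorSemiring.tendsto_pow_div_factorial_atTop (4 * ‖V‖ * |t|)).comp
      (Filter.tendsto_add_atTop_nat 1)).const_mul _).const_add _).const_mul _
  refine (ge_of_tendsto' hlim fun q => ?_).trans_eq (by ring)
  have h := norm_lie_evolution_onParticles_le_iteratedBound h₁ hN hW j B hσ q i hij A (abs_nonneg t)
  rwa [hσt] at h

end Propagation

end MeanField
end

theorem theorem2p1 (ν N m n : ℕ)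
    (U : Space ν → ℝ) (hU : AEMeasurable U volume)
    (V : Lp ℝ ⊤ (volume : Measure (Space ν)))
    (h₁ : IsSelfAdjoint (hamiltonian U V 1)) (hN : IsSelfAdjoint (hamiltonian U V N))
    (A : L2 ν (Fin m) →L[ℂ] L2 ν (Fin m)) (B : L2 ν (Fin n) →L[ℂ] L2 ν (Fin n))
    (i : Fin m ↪o Fin N) (j : Fin n ↪o Fin N) (hij : Disjoint (Set.range i) (Set.range j))
    (t : ℝ) :
    ‖⁅onParticles i A,
        expNegI (hamiltonian U V N) (-t) * onParticles j B * expNegI (hamiltonian U V N) t⁆‖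
      ≤ m * n * ‖A‖ * ‖B‖ / N * (Real.exp (4 * ‖V‖ * |t|) - 1) := by
  have hex : ∃ W, IsUnitaryGroup (hamiltonian U V N) W := exists_isUnitaryGroup hN
  have hE : expNegI (hamiltonian U V N) = hex.choose := by
    funext s
    rw [expNegI, dif_pos hex]
  have hW := hex.choose_spec
  rw [hE]
  set W := hex.choose
  have h := norm_lie_evolution_onParticles_le_exp h₁ hN hW i j hij A B (-t)
  rw [neg_neg, abs_neg] at h
  -- Conjugation moves the evolution from `B` to `A`, with time reversed; the bound depends only on
  -- `|t|`.
  have e : ⁅onParticles i A, W (-t) * onParticles j B * W t⁆ =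
      W (-t) * ⁅W t * onParticles i A * W (-t), onParticles j B⁆ * W t := by
    have e1 : ∀ x, W (-t) * (W t * x) = x := fun x => by rw [← mul_assoc, hW.neg_mul, one_mul]
    simp only [Ring.lie_def, mul_sub, sub_mul, mul_assoc, e1, hW.neg_mul, mul_one]
  rw [e]
  exact (norm_mul_mul_le_of_le_one (hW.norm_le _) (hW.norm_le _)).trans h
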